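/- Let $M$ be a complex manifold with a Kähler form $\omega$ (definiteness of the metric is not needed: $\omega$ may be any closed nondegenerate real $(1,1)$-form). In holomorphic coordinates $z^k$ write $\omega=-i\,g_{k\bar l}\,dz^k\wedge d\bar z^l$, let $(g^{\bar lk})$ be the inverse matrix of $(g_{k\bar l})$, $\partial_k=\partial/\partial z^k$, $\bar\partial_l=\partial/\partial\bar z^l$, and sum over repeated indices. A star-product on $M$ is an associative, $\nu$-linear and $\nu$-adically continuous product $f\ast h=\sum_{r\ge0}\nu^rC_r(f,h)$ on $C^\infty(M)[[\nu]]$ with bidifferential operators $C_r$ (which therefore restricts to open subsets), with unit $1$, $C_0(f,h)=fh$ and $C_1(f,h)-C_1(h,f)=i\{f,h\}$, where $\{f,h\}=i\,g^{\bar lk}(\partial_kf\,\bar\partial_lh-\bar\partial_lf\,\partial_kh)$. It has separation of variables if on every open set $a\ast f=af$ and $f\ast b=bf$ for $a$ holomorphic, $b$ antiholomorphic and $f$ smooth. The standard star-product with separation of variables is the one such that on every contractible holomorphic chart $U$ and for every Kähler potential $\Phi$ on $U$ (a smooth real function with $g_{k\bar l}=\partial_k\bar\partial_l\Phi$) one has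 $\partial_k\Phi\ast f=\partial_k\Phi\, f+\nu\,\partial_kf$ and $f\ast\bar\partial_l\Phi=\bar\partial_l\Phi\, f+\nu\,\bar\partial_lf$ for all $f\in C^\infty(U)$. Let $\ast$ be the standard star-product with separation of variables, and let $(U,\{z^k\})$ be a holomorphic chart on which $\omega$ has a Kähler potential. Let $\Gamma_{kp}^s=(\partial_kg_{p\bar t})g^{\bar ts}$ and $\Gamma_{\bar l\bar q}^{\bar t}=g^{\bar ts}\,\bar\partial_lg_{s\bar q}$ be the Christoffel symbols of the Kähler connection $\nabla$; let $f_{/k}=\partial_kf$, $f_{/kp}$, $f_{/kps}$ and $f_{/\bar l}=\bar\partial_lf$, $f_{/\bar l\bar q}$, $f_{/\bar l\bar q\bar t}$ be the iterated covariant derivatives of a function $f$; let $R^p_{mk\bar l}=-\bar\partial_l\Gamma^p_{km}$ be the curvature of $\nabla$ and $R^{\bar lk\bar qp}=g^{\bar la}g^{\bar bk}g^{\bar qm}R^p_{ma\bar b}$. Then for all $\phi,\psi$ smooth on an open subset of $U$ one has there $$C_1(\phi,\psi)=g^{\bar lk}\phi_{/\bar l}\,\psi_{/k},$$ $$C_2(\phi,\psi)=\tfrac12\bigl(g^{\bar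 qp}g^{\bar lk}(\bar\partial_l\bar\partial_q\phi)(\partial_k\partial_p\psi)+g^{\bar qp}(\partial_pg^{\bar lk})(\bar\partial_l\bar\partial_q\phi)(\partial_k\psi)+(\bar\partial_lg^{\bar qp})g^{\bar lk}(\bar\partial_q\phi)(\partial_k\partial_p\psi)+(\bar\partial_lg^{\bar qp})(\partial_pg^{\bar lk})(\bar\partial_q\phi)(\partial_k\psi)\bigr)=\tfrac12g^{\bar lk}g^{\bar qp}\phi_{/\bar l\bar q}\,\psi_{/kp},$$ $$C_3(\phi,\psi)=\tfrac16g^{\bar lk}g^{\bar qp}g^{\bar ts}\phi_{/\bar l\bar q\bar t}\,\psi_{/kps}+\tfrac14R^{\bar lk\bar qp}\phi_{/\bar l\bar q}\,\psi_{/kp}.$$ -/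

import Mathlib

open scoped Manifold ContDiff Topology

noncomputable section

namespace KahlerStar

/-! ## Smooth and holomorphic functions, Wirtinger derivatives in holomorphic charts -/

section Charts

variable {n : ℕ} {M : Type*} [TopologicalSpace M] [ChartedSpace (Fin n → ℂ) M]

/-- `f` is a (real-)smooth complex-valued function on `U`. -/
def SmoothOn (n : ℕ) {M : Type*} [TopologicalSpace M] [ChartedSpace (Fin n → ℂ) M]
    (f : M → ℂ) (U : Set M) : Prop :=
  ContMDiffOn 𝓘(ℝ, Fin n → ℂ) 𝓘(ℝ, ℂ) ∞ f U

/-- `f` is holomorphic on `U`. -/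
def HolomorphicOn (n : ℕ) {M : Type*} [TopologicalSpace M] [ChartedSpace (Fin n → ℂ) M]
    (f : M → ℂ) (U : Set M) : Prop :=
  MDifferentiableOn 𝓘(ℂ, Fin n → ℂ) 𝓘(ℂ, ℂ) f U

/-- `f` is antiholomorphic on `U`, i.e. its complex conjugate is holomorphic. -/
def AntiholomorphicOn (n : ℕ) {M : Type*} [TopologicalSpace M] [ChartedSpace (Fin n → ℂ) M]
    (f : M → ℂ) (U : Set M) : Prop :=
  HolomorphicOn n (fun x => starRingEnd ℂ (f x)) U

/-- Holomorphic coordinate charts of the complex manifold `M`. The coordinates of the chart `e`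
on its domain `e.source` are `z^k = (e ·) k`. -/
def IsHolChart (e : OpenPartialHomeomorph M (Fin n → ℂ)) : Prop :=
  e ∈ IsManifold.maximalAtlas 𝓘(ℂ, Fin n → ℂ) ω M

/-- The Wirtinger derivative `∂_k = ∂/∂z^k = ½ (∂/∂x^k - i ∂/∂y^k)` in the chart `e`
(meaningful on `e.source`). -/
def del (e : OpenPartialHomeomorph M (Fin n → ℂ)) (k : Fin n) (f : M → ℂ) : M → ℂ := fun x =>
  (fderiv ℝ (f ∘ e.symm) (e x) (Pi.single k 1)
    - Complex.I * fderiv ℝ (f ∘ e.symm) (e x) (Pi.single k Complex.I)) / 2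

/-- The Wirtinger derivative `∂̄_l = ∂/∂z̄^l = ½ (∂/∂x^l + i ∂/∂y^l)` in the chart `e`
(meaningful on `e.source`). -/
def delBar (e : OpenPartialHomeomorph M (Fin n → ℂ)) (l : Fin n) (f : M → ℂ) : M → ℂ := fun x =>
  (fderiv ℝ (f ∘ e.symm) (e x) (Pi.single l 1)
    + Complex.I * fderiv ℝ (f ∘ e.symm) (e x) (Pi.single l Complex.I)) / 2

/-- Iterated coordinate derivatives along a word of holomorphic (`inl k`) and antiholomorphic
(`inr l`) indices. -/
def iterDel (e : OpenPartialHomeomorph M (Fin n → ℂ)) :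
    List (Fin n ⊕ Fin n) → (M → ℂ) → (M → ℂ)
  | [], f => f
  | Sum.inl k :: w, f => del e k (iterDel e w f)
  | Sum.inr l :: w, f => delBar e l (iterDel e w f)

/-- Bidifferential operators on `M`, together with their restrictions to all open subsets:
in every holomorphic chart, near every point, `B` is a finite sum
`B(f,g) = ∑ c_{v,w} (∂^v f) (∂^w g)` with smooth coefficients, for all functions `f`, `g` which are
smooth on some open set `W`, at the points of `W`. The values of `B f g` at points near which
`f` or `g` is not smooth carry no meaning. -/
def IsBidifferential (B : (M → ℂ) → (M → ℂ) → (M → ℂ)) : Prop :=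
  ∀ e : OpenPartialHomeomorph M (Fin n → ℂ), IsHolChart e → ∀ x ∈ e.source,
    ∃ V : Set M, IsOpen V ∧ x ∈ V ∧ V ⊆ e.source ∧
    ∃ (S : Finset (List (Fin n ⊕ Fin n) × List (Fin n ⊕ Fin n)))
      (c : List (Fin n ⊕ Fin n) × List (Fin n ⊕ Fin n) → M → ℂ),
      (∀ p ∈ S, SmoothOn n (c p) V) ∧
      ∀ (W : Set M) (f g : M → ℂ), IsOpen W → W ⊆ V → SmoothOn n f W → SmoothOn n g W →
        ∀ y ∈ W, B f g y = ∑ p ∈ S, c p y * iterDel e p.1 f y * iterDel e p.2 g y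

end Charts

/-! ## Kähler and pseudo-Kähler forms -/

section Kahler

variable {n : ℕ} {M : Type*} [TopologicalSpace M] [ChartedSpace (Fin n → ℂ) M]

/-- The coordinate expression at `z ∈ e.target` of a field `F` of real bilinear forms on the
tangent spaces, i.e. its pullback by `e.symm`. -/
def pullForm (F : ∀ x : M, LinearMap.BilinForm ℝ (TangentSpace 𝓘(ℂ, Fin n → ℂ) x))
    (e : OpenPartialHomeomorph M (Fin n → ℂ)) (z v w : Fin n → ℂ) : ℝ :=
  F (e.symm z)
    (mfderiv 𝓘(ℂ, Fin n → ℂ) 𝓘(ℂ, Fin n → ℂ) e.symm z v)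
    (mfderiv 𝓘(ℂ, Fin n → ℂ) 𝓘(ℂ, Fin n → ℂ) e.symm z w)

/-- The components `g_{k l̄} = i F(∂_k, ∂̄_l)` in the chart `e`, so that a real form `F` of
type (1,1) is `-i g_{k l̄} dz^k ∧ dz̄^l`. Here `F` is extended complex-bilinearly to
`∂_k = ½ (∂/∂x^k - i ∂/∂y^k)` and `∂̄_l = ½ (∂/∂x^l + i ∂/∂y^l)`. -/
def formCoeff (F : ∀ x : M, LinearMap.BilinForm ℝ (TangentSpace 𝓘(ℂ, Fin n → ℂ) x))
    (e : OpenPartialHomeomorph M (Fin n → ℂ)) (k l : Fin n) : M → ℂ := fun x =>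
  Complex.I * (1 / 4) *
    ((pullForm F e (e x) (Pi.single k 1) (Pi.single l 1) : ℂ)
      + (pullForm F e (e x) (Pi.single k Complex.I) (Pi.single l Complex.I) : ℂ)
      + Complex.I * ((pullForm F e (e x) (Pi.single k 1) (Pi.single l Complex.I) : ℂ)
        - (pullForm F e (e x) (Pi.single k Complex.I) (Pi.single l 1) : ℂ)))

/-- A pseudo-Kähler form on the complex manifold `M`: a smooth closed
nondegenerate real 2-form of type (1,1). Kähler forms are those for which `g_{k l̄}` is definite
(of either sign, depending on the convention). -/
structure PseudoKahlerForm (n : ℕ) (M : Type*) [TopologicalSpace M] [ChartedSpace (Fin n → ℂ) M] where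
  form : ∀ x : M, LinearMap.BilinForm ℝ (TangentSpace 𝓘(ℂ, Fin n → ℂ) x)
  alternating : ∀ x v, form x v v = 0
  type_one_one : ∀ x v w, form x (Complex.I • v) (Complex.I • w) = form x v w
  nondegenerate : ∀ x v, (∀ w, form x v w = 0) → v = 0
  smooth : ∀ e : OpenPartialHomeomorph M (Fin n → ℂ), IsHolChart e →
    ∀ k l, SmoothOn n (formCoeff form e k l) e.source
  closed : ∀ e : OpenPartialHomeomorph M (Fin n → ℂ), IsHolChart e → ∀ x ∈ e.source, ∀ k p l,
    del e p (formCoeff form e k l) x = del e k (formCoeff form e p l) x ∧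
    delBar e p (formCoeff form e l k) x = delBar e k (formCoeff form e l p) x

namespace PseudoKahlerForm

variable (Ω : PseudoKahlerForm n M) (e : OpenPartialHomeomorph M (Fin n → ℂ))

/-- The metric tensor `g_{k l̄}` in the chart `e`. -/
def g (k l : Fin n) : M → ℂ := formCoeff Ω.form e k l

/-- The inverse metric tensor `g^{l̄ k}` in the chart `e`; the first argument is the
antiholomorphic index. -/
def gInv (l k : Fin n) : M → ℂ := fun x => (Matrix.of fun a b => Ω.g e a b x)⁻¹ l k

/-- `Φ` is a Kähler potential of the form on the domain of the chart `e`. -/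
def IsPotential (Φ : M → ℝ) : Prop :=
  SmoothOn n (fun x => (Φ x : ℂ)) e.source ∧
  ∀ x ∈ e.source, ∀ k l, Ω.g e k l x = del e k (delBar e l fun y => (Φ y : ℂ)) x

/-- The Poisson bracket of the bivector field `η = i g^{l̄ k} ∂_k ∧ ∂̄_l`. -/
def bracket (f h : M → ℂ) : M → ℂ := fun x =>
  Complex.I * ∑ l, ∑ k, Ω.gInv e l k x *
    (del e k f x * delBar e l h x - delBar e l f x * del e k h x)

/-- The Christoffel symbol `Γ_{kp}^s = (∂_k g_{p t̄}) g^{t̄ s}` of the Kähler connection. -/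
def christoffel (k p s : Fin n) : M → ℂ := fun x =>
  ∑ t, del e k (Ω.g e p t) x * Ω.gInv e t s x

/-- The Christoffel symbol `Γ_{l̄ q̄}^{t̄} = g^{t̄ s} (∂̄_l g_{s q̄})` of the Kähler connection. -/
def christoffelBar (l q t : Fin n) : M → ℂ := fun x =>
  ∑ s, Ω.gInv e t s x * delBar e l (Ω.g e s q) x

/-- The covariant derivatives `f_{/kp}`. -/
def cov2 (f : M → ℂ) (k p : Fin n) : M → ℂ := fun x =>
  del e p (del e k f) x - ∑ m, Ω.christoffel e p k m x * del e m f x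

/-- The covariant derivatives `f_{/kps}`. -/
def cov3 (f : M → ℂ) (k p s : Fin n) : M → ℂ := fun x =>
  del e s (Ω.cov2 e f k p) x
    - ∑ m, Ω.christoffel e s k m x * Ω.cov2 e f m p x
    - ∑ m, Ω.christoffel e s p m x * Ω.cov2 e f k m x

/-- The covariant derivatives `f_{/l̄ q̄}`. -/
def covBar2 (f : M → ℂ) (l q : Fin n) : M → ℂ := fun x =>
  delBar e q (delBar e l f) x - ∑ m, Ω.christoffelBar e q l m x * delBar e m f x

/-- The covariant derivatives `f_{/l̄ q̄ t̄}`. -/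
def covBar3 (f : M → ℂ) (l q t : Fin n) : M → ℂ := fun x =>
  delBar e t (Ω.covBar2 e f l q) x
    - ∑ m, Ω.christoffelBar e t l m x * Ω.covBar2 e f m q x
    - ∑ m, Ω.christoffelBar e t q m x * Ω.covBar2 e f l m x

/-- The curvature `R^p_{m k l̄}` of the Kähler connection, the coefficient of `∂_p` in
`R(∂_k, ∂̄_l) ∂_m = ∇_k ∇_{l̄} ∂_m - ∇_{l̄} ∇_k ∂_m = -(∂̄_l Γ_{km}^p) ∂_p`. -/
def curvature (p m k l : Fin n) : M → ℂ := fun x => -delBar e l (Ω.christoffel e k m p) x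

/-- The curvature with two raised indices, `R_{k l̄}^{q̄ p} = g^{q̄ m} R^p_{m k l̄}`. -/
def curvatureMixed (k l q p : Fin n) : M → ℂ := fun x =>
  ∑ m, Ω.gInv e q m x * Ω.curvature e p m k l x

/-- The curvature with all indices raised, `R^{l̄ k q̄ p} = g^{l̄ a} g^{b̄ k} R_{a b̄}^{q̄ p}`. -/
def curvatureUp (l k q p : Fin n) : M → ℂ := fun x =>
  ∑ a, ∑ b, Ω.gInv e l a x * Ω.gInv e b k x * Ω.curvatureMixed e a b q p x

end PseudoKahlerForm

end Kahler

/-! ## Star-products -/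

section Star

variable {n : ℕ} {M : Type*} [TopologicalSpace M] [ChartedSpace (Fin n → ℂ) M]

/-- The `ν`-linear, `ν`-adically continuous product on formal series with
`f * h = ∑_r ν^r C_r(f,h)` for functions `f`, `h`. -/
def star (C : ℕ → (M → ℂ) → (M → ℂ) → (M → ℂ)) (F G : PowerSeries (M → ℂ)) :
    PowerSeries (M → ℂ) :=
  PowerSeries.mk fun N => ∑ a ∈ Finset.HasAntidiagonal.antidiagonal N,
    ∑ b ∈ Finset.HasAntidiagonal.antidiagonal a.2,
    C a.1 (PowerSeries.coeff b.1 F) (PowerSeries.coeff b.2 G)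

/-- Formal series with coefficients in `C^∞(U)`. -/
def SmoothSeriesOn (n : ℕ) {M : Type*} [TopologicalSpace M] [ChartedSpace (Fin n → ℂ) M]
    (F : PowerSeries (M → ℂ)) (U : Set M) : Prop :=
  ∀ r, SmoothOn n (PowerSeries.coeff r F) U

/-- Equality on `U` of formal series of functions. -/
def SeriesEqOn (F G : PowerSeries (M → ℂ)) (U : Set M) : Prop :=
  ∀ r, Set.EqOn (PowerSeries.coeff r F) (PowerSeries.coeff r G) U

/-- `C` defines a differentiable deformation quantization (star-product) on `M` with the Poisson
structure inverse to `Ω`, localized to all open subsets `U` of `M`. -/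
structure IsStarProduct (Ω : PseudoKahlerForm n M) (C : ℕ → (M → ℂ) → (M → ℂ) → (M → ℂ)) : Prop where
  bidifferential : ∀ r, IsBidifferential (n := n) (C r)
  assoc : ∀ (U : Set M) (F G H : PowerSeries (M → ℂ)), IsOpen U →
    SmoothSeriesOn n F U → SmoothSeriesOn n G U → SmoothSeriesOn n H U →
    SeriesEqOn (star C (star C F G) H) (star C F (star C G H)) U
  one_left : ∀ (U : Set M) (F : PowerSeries (M → ℂ)), IsOpen U → SmoothSeriesOn n F U →
    SeriesEqOn (star C 1 F) F U
  one_right : ∀ (U : Set M) (F : PowerSeries (M → ℂ)), IsOpen U → SmoothSeriesOn n F U →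
    SeriesEqOn (star C F 1) F U
  zeroth : ∀ (U : Set M) (f h : M → ℂ), IsOpen U → SmoothOn n f U → SmoothOn n h U →
    Set.EqOn (C 0 f h) (f * h) U
  first : ∀ e : OpenPartialHomeomorph M (Fin n → ℂ), IsHolChart e →
    ∀ (U : Set M) (f h : M → ℂ), IsOpen U → U ⊆ e.source → SmoothOn n f U → SmoothOn n h U →
    Set.EqOn (C 1 f h - C 1 h f) (fun x => Complex.I * Ω.bracket e f h x) U

/-- Star-products with separation of variables: `a * f = a f` for `a` holomorphic and
`f * b = b f` for `b` antiholomorphic, on every open subset. -/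
structure IsSeparationOfVariables (Ω : PseudoKahlerForm n M)
    (C : ℕ → (M → ℂ) → (M → ℂ) → (M → ℂ)) : Prop extends IsStarProduct Ω C where
  left_holomorphic : ∀ (U : Set M) (a f : M → ℂ), IsOpen U → HolomorphicOn n a U →
    SmoothOn n f U → SeriesEqOn (star C (PowerSeries.C a) (PowerSeries.C f))
      (PowerSeries.C (a * f)) U
  right_antiholomorphic : ∀ (U : Set M) (b f : M → ℂ), IsOpen U → AntiholomorphicOn n b U →
    SmoothOn n f U → SeriesEqOn (star C (PowerSeries.C f) (PowerSeries.C b))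
      (PowerSeries.C (b * f)) U

/-- The standard star-product with separation of variables: on every contractible holomorphic
chart and for every Kähler potential `Φ` on it, `L_{∂_k Φ} = ∂_k Φ + ν ∂_k` and
`R_{∂̄_l Φ} = ∂̄_l Φ + ν ∂̄_l`. -/
structure IsStandard (Ω : PseudoKahlerForm n M)
    (C : ℕ → (M → ℂ) → (M → ℂ) → (M → ℂ)) : Prop extends IsSeparationOfVariables Ω C where
  left_potential : ∀ e : OpenPartialHomeomorph M (Fin n → ℂ), IsHolChart e →
    ContractibleSpace e.source → ∀ Φ : M → ℝ, Ω.IsPotential e Φ →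
    ∀ (k : Fin n) (f : M → ℂ), SmoothOn n f e.source →
      SeriesEqOn
        (star C (PowerSeries.C (del e k fun x => (Φ x : ℂ))) (PowerSeries.C f))
        (PowerSeries.C ((del e k fun x => (Φ x : ℂ)) * f)
          + PowerSeries.X * PowerSeries.C (del e k f)) e.source
  right_potential : ∀ e : OpenPartialHomeomorph M (Fin n → ℂ), IsHolChart e →
    ContractibleSpace e.source → ∀ Φ : M → ℝ, Ω.IsPotential e Φ →
    ∀ (l : Fin n) (f : M → ℂ), SmoothOn n f e.source →
      SeriesEqOn
        (star C (PowerSeries.C f) (PowerSeries.C (delBar e l fun x => (Φ x : ℂ))))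
        (PowerSeries.C ((delBar e l fun x => (Φ x : ℂ)) * f)
          + PowerSeries.X * PowerSeries.C (delBar e l f)) e.source

end Star

end KahlerStar

end

/-! ### Tensor calculus over an abstract algebra with a Kähler potential -/

namespace KahlerStar

/-! Put u_k = ∂_kΦ. Left star-multiplication by u_k is u_k + ν∂_k, and by a holomorphic function a
it is multiplication by a. Comparing coefficients of ν^(r+1) in (u_k ∗ f) ∗ h = u_k ∗ (f ∗ h) gives
C_{r+1}(u_k f, h) = u_k C_{r+1}(f, h) + ∂_k C_r(f, h) - C_r(∂_k f, h) (`IsStdStar.D_pot_mul`);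
similarly C_{r+1}(a f, h) = a C_{r+1}(f, h), and C_{r+1}(1, h) = 0.

These relations determine C_{r+1} from C_r. For fixed h, the difference A of two solutions is
additive, kills 1, and commutes with multiplication by constants, by z^k and by u_k. Because ∂̄_l
u_k = g_{k l̄} is invertible, the z^k and u_k can replace the z^k and z̄^k as local coordinates: by
Hadamard's lemma every smooth f on a small ball is f(y) + ∑ (z^k - z^k(y)) a_k + ∑ (u_k - u_k(y))
b_k with smooth a_k, b_k (`hasExpansion`). Applying A and evaluating at y gives (A f)(y) = 0
(`ev_eq_zero_of_commute`). The uniqueness statement is `IsStdStar.eq_of_recursion`.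

It remains to check that the proposed formulas solve the recursion. The metric is parallel, so the
second barred covariant derivatives of u_k vanish (`covb2_D_pot`); multiplying f by u_k inside a
contraction then only produces terms in which one factor g_{k l̄} is contracted away and k takes a
slot of h. This is compared with the commutator of ∂_k and the preceding contraction. Second order
closes because 1/2 · 2 = 1. At third order ∂_k does not commute with barred second covariant
derivatives, and the commutator is a curvature term (`D_covb2`, `D_B2`); the curvature summand of
C_3 compensates exactly for it, through 1/6 · 3 = 1/2 and 1/4 · (-2) = -1/2 (`B3_D_pot_mul`,
`BR_D_pot_mul`).

The calculation takes place in the algebra of smooth functions on a ball in coordinates, to which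
the star-product is transported by locality of bidifferential operators. -/

/-- A commutative algebra with commuting families of derivations `∂_k`, `∂̄_l` and a potential
whose mixed second derivatives form an invertible matrix. -/
structure KahlerAlgebra (ι R : Type*) [Fintype ι] [DecidableEq ι] [CommRing R] [Algebra ℂ R] where
  D : ι → Derivation ℂ R R
  Db : ι → Derivation ℂ R R
  pot : R
  gi : ι → ι → R
  D_comm : ∀ k p f, D k (D p f) = D p (D k f)
  Db_comm : ∀ l q f, Db l (Db q f) = Db q (Db l f)
  D_Db : ∀ k l f, D k (Db l f) = Db l (D k f)
  g_gi : ∀ k p, ∑ l, D k (Db l pot) * gi l p = if k = p then 1 else 0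
  gi_g : ∀ l q, ∑ k, gi l k * D k (Db q pot) = if l = q then 1 else 0

namespace KahlerAlgebra

variable {ι R : Type*} [Fintype ι] [DecidableEq ι] [CommRing R] [Algebra ℂ R]
  (K : KahlerAlgebra ι R)

/-- The metric `g_{k l̄}`. -/
def g (k l : ι) : R := K.D k (K.Db l K.pot)

/-- The Christoffel symbol `Γ_{kp}^s`. -/
def chr (k p s : ι) : R := ∑ t, K.D k (K.g p t) * K.gi t s

/-- The Christoffel symbol `Γ_{l̄ q̄}^{t̄}`. -/
def chrb (l q t : ι) : R := ∑ s, K.gi t s * K.Db l (K.g s q)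

/-- The covariant derivative `f_{/kp}`. -/
def cov2 (f : R) (k p : ι) : R := K.D p (K.D k f) - ∑ m, K.chr p k m * K.D m f

/-- The covariant derivative `f_{/kps}`. -/
def cov3 (f : R) (k p s : ι) : R :=
  K.D s (K.cov2 f k p) - ∑ m, K.chr s k m * K.cov2 f m p - ∑ m, K.chr s p m * K.cov2 f k m

/-- The covariant derivative `f_{/l̄ q̄}`. -/
def covb2 (f : R) (l q : ι) : R := K.Db q (K.Db l f) - ∑ m, K.chrb q l m * K.Db m f

/-- The covariant derivative `f_{/l̄ q̄ t̄}`. -/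
def covb3 (f : R) (l q t : ι) : R :=
  K.Db t (K.covb2 f l q) - ∑ m, K.chrb t l m * K.covb2 f m q - ∑ m, K.chrb t q m * K.covb2 f l m

/-- The curvature `R^{l̄ k q̄ p}` with raised indices. -/
def curvUp (l k q p : ι) : R :=
  ∑ a, ∑ b, K.gi l a * K.gi b k * ∑ m, K.gi q m * -K.Db b (K.chr a m p)

/-- The bidifferential operator `g^{l̄k} φ_{/l̄} ψ_{/k}`. -/
def B1 (f h : R) : R := ∑ l, ∑ k, K.gi l k * K.Db l f * K.D k h

/-- The contraction `g^{l̄k} g^{q̄p} φ_{/l̄q̄} ψ_{/kp}`. -/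
def B2 (f h : R) : R :=
  ∑ l, ∑ k, ∑ q, ∑ p, K.gi l k * K.gi q p * K.covb2 f l q * K.cov2 h k p

/-- The contraction `g^{l̄k} g^{q̄p} g^{t̄s} φ_{/l̄q̄t̄} ψ_{/kps}`. -/
def B3 (f h : R) : R :=
  ∑ l, ∑ k, ∑ q, ∑ p, ∑ t, ∑ s,
    K.gi l k * K.gi q p * K.gi t s * K.covb3 f l q t * K.cov3 h k p s

/-- The contraction `R^{l̄kq̄p} φ_{/l̄q̄} ψ_{/kp}`. -/
def BR (f h : R) : R := ∑ l, ∑ k, ∑ q, ∑ p, K.curvUp l k q p * K.covb2 f l q * K.cov2 h k p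

lemma sum_g_gi (k p : ι) : ∑ l, K.g k l * K.gi l p = if k = p then 1 else 0 := K.g_gi k p

lemma sum_gi_g (l q : ι) : ∑ k, K.gi l k * K.g k q = if l = q then 1 else 0 := K.gi_g l q

lemma contract (k : ι) (X : ι → R) : ∑ t, ∑ s, K.gi t s * (K.g k t * X s) = X k := by
  rw [Finset.sum_comm]
  have : ∀ s, ∑ t, K.gi t s * (K.g k t * X s) = (∑ t, K.g k t * K.gi t s) * X s := fun s => by
    rw [Finset.sum_mul]; exact Finset.sum_congr rfl fun t _ => by ring
  simp [this, sum_g_gi]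

/-- Closedness of the form; here it is immediate from the potential and the commutation of the ∂_k.
-/
lemma D_g_symm (p k l : ι) : K.D p (K.g k l) = K.D k (K.g p l) := K.D_comm p k _

lemma Db_g_symm (q k l : ι) : K.Db q (K.g k l) = K.Db l (K.g k q) := by
  simp only [g, ← K.D_Db, K.Db_comm q l]

lemma chr_symm (k p s : ι) : K.chr k p s = K.chr p k s := by
  simp only [chr, K.D_g_symm k p]

lemma chrb_symm (l q t : ι) : K.chrb l q t = K.chrb q l t := by
  simp only [chrb, K.Db_g_symm l _ q]

/-- Differentiate g⁻¹ g = 1 and multiply by g⁻¹ on the right. -/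
lemma derivation_gi (δ : Derivation ℂ R R) (q p : ι) :
    δ (K.gi q p) = -∑ s, ∑ t, K.gi q s * δ (K.g s t) * K.gi t p := by
  have h0 : ∀ t, ∑ s, δ (K.gi q s) * K.g s t = -∑ s, K.gi q s * δ (K.g s t) := fun t => by
    have := congrArg δ (K.sum_gi_g q t)
    rw [map_sum, apply_ite δ] at this
    simp only [Derivation.leibniz, smul_eq_mul, Derivation.map_one_eq_zero, map_zero, ite_self,
      Finset.sum_add_distrib] at this
    rw [eq_neg_iff_add_eq_zero, ← this, add_comm]
    congr 1; exact Finset.sum_congr rfl fun s _ => mul_comm _ _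
  calc δ (K.gi q p) = ∑ s, δ (K.gi q s) * ∑ t, K.g s t * K.gi t p := by simp [sum_g_gi]
    _ = ∑ t, (∑ s, δ (K.gi q s) * K.g s t) * K.gi t p := by
      simp only [Finset.mul_sum, Finset.sum_mul, mul_assoc]; exact Finset.sum_comm
    _ = _ := by
      simp only [h0, neg_mul, Finset.sum_mul, Finset.sum_neg_distrib]; rw [Finset.sum_comm]

lemma D_gi (k q p : ι) : K.D k (K.gi q p) = -∑ s, K.gi q s * K.chr k s p := by
  simp only [derivation_gi, chr, Finset.mul_sum, mul_assoc]

lemma Db_gi (l q p : ι) : K.Db l (K.gi q p) = -∑ t, K.chrb l t q * K.gi t p := by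
  rw [derivation_gi, Finset.sum_comm]; simp only [chrb, Finset.sum_mul]

/-- The metric is parallel. This makes the second barred covariant derivatives of ∂_kΦ vanish. -/
lemma sum_chrb_g (q l k : ι) : ∑ m, K.chrb q l m * K.g k m = K.Db q (K.g k l) := by
  simp only [chrb, Finset.sum_mul]
  rw [← K.contract k fun s => K.Db q (K.g s l)]
  exact Finset.sum_congr rfl fun t _ => Finset.sum_congr rfl fun s _ => by ring

lemma cov2_symm (f : R) (k p : ι) : K.cov2 f k p = K.cov2 f p k := by
  simp only [cov2, K.D_comm p k, K.chr_symm p k]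

lemma covb2_symm (f : R) (l q : ι) : K.covb2 f l q = K.covb2 f q l := by
  simp only [covb2, K.Db_comm q l, K.chrb_symm q l]

/-- `∂_s Γ_{pk}^m`, with the derivatives of the inverse metric expanded. -/
lemma D_chr (s p k m : ι) : K.D s (K.chr p k m) =
    ∑ t, K.D s (K.D p (K.g k t)) * K.gi t m - ∑ a, K.chr p k a * K.chr s a m := by
  have : ∑ a, K.chr p k a * K.chr s a m =
      -∑ t, K.D p (K.g k t) * K.D s (K.gi t m) := by
    simp only [D_gi, mul_neg, Finset.sum_neg_distrib, neg_neg, Finset.mul_sum]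
    rw [Finset.sum_comm]
    refine Finset.sum_congr rfl fun a _ => ?_
    rw [chr, Finset.sum_mul]; exact Finset.sum_congr rfl fun t _ => by ring
  rw [this, chr, map_sum, sub_neg_eq_add, ← Finset.sum_add_distrib]
  refine Finset.sum_congr rfl fun t _ => ?_
  simp only [Derivation.leibniz, smul_eq_mul]; ring

lemma cov3_symm_left (f : R) (k p s : ι) : K.cov3 f k p s = K.cov3 f p k s := by
  simp only [cov3, K.cov2_symm f k p, K.cov2_symm f _ p, K.cov2_symm f k]; ring

/-- The Kähler connection has no curvature of type (2,0), so holomorphic covariant derivatives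
commute. -/
lemma cov3_symm_right (f : R) (k p s : ι) : K.cov3 f k p s = K.cov3 f k s p := by
  -- Each group on the right is symmetric in p and s once ∂_s∂_p = ∂_p∂_s and Γ_{sp} = Γ_{ps} are
  -- used; the ΓΓ terms appear as a symmetric pair.
  have e : ∀ p s, K.cov3 f k p s = K.D s (K.D p (K.D k f))
      - ∑ m, (∑ t, K.D s (K.D p (K.g k t)) * K.gi t m) * K.D m f
      - (∑ m, K.chr p k m * K.D s (K.D m f) + ∑ m, K.chr s k m * K.D p (K.D m f))
      + (∑ m, (∑ a, K.chr p k a * K.chr s a m) * K.D m f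
        + ∑ m, (∑ a, K.chr s k a * K.chr p a m) * K.D m f)
      - ∑ m, K.chr s p m * K.cov2 f k m := fun p s => by
    have h1 : ∑ m, (∑ a, K.chr s k a * K.chr p a m) * K.D m f
        = ∑ a, K.chr s k a * ∑ m, K.chr p a m * K.D m f := by
      simp only [Finset.sum_mul, Finset.mul_sum, mul_assoc]; exact Finset.sum_comm
    have h2 : ∑ m, (K.D s (K.chr p k m)) * K.D m f
        = ∑ m, (∑ t, K.D s (K.D p (K.g k t)) * K.gi t m) * K.D m f
          - ∑ m, (∑ a, K.chr p k a * K.chr s a m) * K.D m f := by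
      simp only [D_chr, sub_mul, Finset.sum_sub_distrib]
    have h3 : ∑ m, K.chr s k m * K.cov2 f m p = ∑ m, K.chr s k m * K.D p (K.D m f)
        - ∑ a, K.chr s k a * ∑ m, K.chr p a m * K.D m f := by
      simp only [cov2, mul_sub, Finset.sum_sub_distrib]
    have h4 : K.D s (K.cov2 f k p) = K.D s (K.D p (K.D k f))
        - ∑ m, K.chr p k m * K.D s (K.D m f) - ∑ m, (K.D s (K.chr p k m)) * K.D m f := by
      simp only [cov2, map_sub, map_sum, Derivation.leibniz, smul_eq_mul, Finset.sum_add_distrib]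
      simp only [mul_comm (K.D _ f), sub_sub]
    rw [cov3, h4, h3, h2, h1]; ring
  rw [e p s, e s p]
  simp only [K.D_comm s p, K.chr_symm s p]; ring

/-- The curvature with lowered indices, up to sign. -/
def low (a m b t : ι) : R :=
  K.Db b (K.D a (K.g m t)) - ∑ s, K.chr a m s * K.Db b (K.g s t)

/-- The first term of `low` is a fourth derivative of the potential; this and the symmetry of Γ and
∂̄g give both curvature symmetries. -/
lemma low_symm_left (a m b t : ι) : K.low a m b t = K.low m a b t := by
  simp only [low, K.D_g_symm a m, K.chr_symm a m]

lemma low_symm_right (a m b t : ι) : K.low a m b t = K.low a m t b := by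
  simp only [low, ← K.D_Db, K.Db_g_symm b _ t]

/-- Γ = (∂g)g⁻¹, and the derivative of g⁻¹ supplies the quadratic term of `low`. -/
lemma Db_chr (b a m p : ι) : K.Db b (K.chr a m p) = ∑ t, K.low a m b t * K.gi t p := by
  have h : ∑ t, K.D a (K.g m t) * K.Db b (K.gi t p)
      = -∑ t, (∑ s, K.chr a m s * K.Db b (K.g s t)) * K.gi t p := by
    simp only [derivation_gi, mul_neg, Finset.sum_neg_distrib, Finset.mul_sum, Finset.sum_mul, chr]
    congr 1
    rw [Finset.sum_comm]
    rw [Finset.sum_comm (s := Finset.univ) (t := Finset.univ)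
      (f := fun t s => ∑ i, K.D a (K.g m i) * K.gi i s * K.Db b (K.g s t) * K.gi t p)]
    refine Finset.sum_congr rfl fun s _ => ?_
    rw [Finset.sum_comm]
    exact Finset.sum_congr rfl fun t _ => Finset.sum_congr rfl fun i _ => by ring
  simp only [low, sub_mul, Finset.sum_sub_distrib]
  rw [sub_eq_add_neg, ← h, chr, map_sum, ← Finset.sum_add_distrib]
  refine Finset.sum_congr rfl fun t _ => ?_
  simp only [Derivation.leibniz, smul_eq_mul]; ring

/-- The barred symbols yield the same tensor `low` as the unbarred ones. This is what lets the
commutator term of `D_covb2` cancel against the curvature summand of C_3. -/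
lemma D_chrb (k q l m : ι) : K.D k (K.chrb q l m) = ∑ s, K.gi m s * K.low k s q l := by
  have h : ∑ s, K.D k (K.gi m s) * K.Db q (K.g s l)
      = -∑ s, K.gi m s * ∑ a, K.chr k s a * K.Db q (K.g a l) := by
    simp only [D_gi, neg_mul, Finset.sum_neg_distrib, Finset.mul_sum, Finset.sum_mul]
    rw [Finset.sum_comm]; simp only [mul_assoc]
  simp only [low, mul_sub, Finset.sum_sub_distrib]
  rw [sub_eq_add_neg, ← h, chrb, map_sum, ← Finset.sum_add_distrib]
  refine Finset.sum_congr rfl fun s _ => ?_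
  simp only [Derivation.leibniz, smul_eq_mul, K.D_Db]; ring

end KahlerAlgebra
end KahlerStar

/-! ### Contractions, multiplication by ∂_kΦ, and differentiation of contractions -/

namespace KahlerStar
namespace KahlerAlgebra

lemma sum_swap_pairs {κ S : Type*} [Fintype κ] [AddCommMonoid S]
    (F : κ → κ → κ → κ → S) :
    ∑ l, ∑ q, ∑ k, ∑ p, F l q k p = ∑ k, ∑ p, ∑ l, ∑ q, F l q k p := by
  have h := Finset.sum_comm (s := (Finset.univ : Finset (κ × κ))) (t := Finset.univ)
    (f := fun x y : κ × κ => F x.1 x.2 y.1 y.2)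
  simp only [Fintype.sum_prod_type] at h
  exact h

lemma sum_swap_inner {κ S : Type*} [Fintype κ] [AddCommMonoid S]
    (F : κ → κ → κ → κ → S) :
    ∑ l, ∑ k, ∑ q, ∑ p, F l k q p = ∑ l, ∑ q, ∑ k, ∑ p, F l k q p :=
  Finset.sum_congr rfl fun _ _ => Finset.sum_comm

variable {ι R : Type*} [Fintype ι] [DecidableEq ι] [CommRing R] [Algebra ℂ R]
  (K : KahlerAlgebra ι R)

/-- Contraction of a barred and an unbarred index with the inverse metric. -/
def pair (F H : ι → R) : R := ∑ l, ∑ k, K.gi l k * (F l * H k)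

/-- Contraction of two pairs of indices. -/
def pair2 (F H : ι → ι → R) : R := ∑ l, ∑ k, K.gi l k * K.pair (F l) (H k)

/-- Contraction of three pairs of indices. -/
def pair3 (F H : ι → ι → ι → R) : R := ∑ l, ∑ k, K.gi l k * K.pair2 (F l) (H k)

lemma pair_add_left (F F' H : ι → R) :
    K.pair (fun l => F l + F' l) H = K.pair F H + K.pair F' H := by
  simp only [pair, add_mul, mul_add, Finset.sum_add_distrib]

lemma pair_mul_left (c : R) (F H : ι → R) : K.pair (fun l => c * F l) H = c * K.pair F H := by
  simp only [pair, Finset.mul_sum]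
  exact Finset.sum_congr rfl fun l _ => Finset.sum_congr rfl fun k _ => by ring

lemma pair_sub_right (F H H' : ι → R) :
    K.pair F (fun l => H l - H' l) = K.pair F H - K.pair F H' := by
  simp only [pair, mul_sub, Finset.sum_sub_distrib]

/-- The metric is the derivative of ∂_kΦ, so this is how the index k moves into a slot of the second
argument. -/
lemma pair_g (k : ι) (H : ι → R) : K.pair (K.g k) H = H k := K.contract k H

lemma pair2_add_left (F F' H : ι → ι → R) :
    K.pair2 (fun l q => F l q + F' l q) H = K.pair2 F H + K.pair2 F' H := by
  simp only [pair2, pair_add_left, mul_add, Finset.sum_add_distrib]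

lemma pair2_mul_left (c : R) (F H : ι → ι → R) :
    K.pair2 (fun l q => c * F l q) H = c * K.pair2 F H := by
  simp only [pair2, pair_mul_left, Finset.mul_sum, mul_left_comm]

lemma pair2_neg_left (F H : ι → ι → R) :
    K.pair2 (fun l q => -F l q) H = -K.pair2 F H := by
  simpa using K.pair2_mul_left (-1) F H

lemma pair2_sub_right (F H H' : ι → ι → R) :
    K.pair2 F (fun l q => H l q - H' l q) = K.pair2 F H - K.pair2 F H' := by
  simp only [pair2, pair_sub_right, mul_sub, Finset.sum_sub_distrib]

lemma pair2_g_left (k : ι) (F : ι → R) (H : ι → ι → R) :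
    K.pair2 (fun l q => K.g k l * F q) H = K.pair F (H k) := by
  simp only [pair2, pair_mul_left]; exact K.contract k fun m => K.pair F (H m)

lemma pair2_g_right (k : ι) (F : ι → R) (H : ι → ι → R) :
    K.pair2 (fun l q => F l * K.g k q) H = K.pair F fun m => H m k := by
  simp only [pair2, pair_mul_left]
  simp only [pair_g]; rfl

lemma pair3_add_left (F F' H : ι → ι → ι → R) :
    K.pair3 (fun l q t => F l q t + F' l q t) H = K.pair3 F H + K.pair3 F' H := by
  simp only [pair3, pair2_add_left, mul_add, Finset.sum_add_distrib]

lemma pair3_mul_left (c : R) (F H : ι → ι → ι → R) :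
    K.pair3 (fun l q t => c * F l q t) H = c * K.pair3 F H := by
  simp only [pair3, pair2_mul_left, Finset.mul_sum, mul_left_comm]

lemma pair3_g_left (k : ι) (F : ι → ι → R) (H : ι → ι → ι → R) :
    K.pair3 (fun l q t => K.g k l * F q t) H = K.pair2 F (H k) := by
  simp only [pair3, pair2_mul_left]; exact K.contract k fun m => K.pair2 F (H m)

lemma pair3_g_middle (k : ι) (F : ι → ι → R) (H : ι → ι → ι → R) :
    K.pair3 (fun l q t => K.g k q * F l t) H = K.pair2 F fun m => H m k := by
  simp only [pair3, pair2_g_left]; rfl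

lemma pair3_g_right (k : ι) (F : ι → ι → R) (H : ι → ι → ι → R) :
    K.pair3 (fun l q t => K.g k t * F l q) H = K.pair2 F fun m p => H m p k := by
  simp only [pair3, mul_comm (K.g k _), pair2_g_right]; rfl

lemma B1_eq_pair (f h : R) : K.B1 f h = K.pair (K.Db · f) (K.D · h) := by
  simp only [B1, pair, mul_assoc]

lemma B2_eq_pair (f h : R) : K.B2 f h = K.pair2 (K.covb2 f) (K.cov2 h) := by
  simp only [B2, pair2, pair, mul_assoc, Finset.mul_sum]

lemma B3_eq_pair (f h : R) : K.B3 f h = K.pair3 (K.covb3 f) (K.cov3 h) := by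
  simp only [B3, pair3, pair2, pair, mul_assoc, Finset.mul_sum]

lemma pair2_eq (F H : ι → ι → R) : K.pair2 F H =
    ∑ l, ∑ q, ∑ k, ∑ p, K.gi l k * K.gi q p * (F l q * H k p) := by
  rw [← sum_swap_inner]
  simp only [pair2, pair, Finset.mul_sum]
  exact Finset.sum_congr rfl fun l _ => Finset.sum_congr rfl fun q _ =>
    Finset.sum_congr rfl fun k _ => Finset.sum_congr rfl fun p _ => by ring

lemma curvUp_eq (l k q p : ι) : K.curvUp l k q p =
    -∑ b, ∑ t, K.gi b k * K.gi t p * ∑ a, ∑ m, K.gi l a * K.gi q m * K.low a m b t := by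
  have : K.curvUp l k q p =
      -∑ a, ∑ b, ∑ m, ∑ t, K.gi b k * K.gi t p * (K.gi l a * K.gi q m * K.low a m b t) := by
    rw [curvUp, ← Finset.sum_neg_distrib]
    refine Finset.sum_congr rfl fun a _ => ?_
    rw [← Finset.sum_neg_distrib]
    refine Finset.sum_congr rfl fun b _ => ?_
    rw [Finset.mul_sum, ← Finset.sum_neg_distrib]
    refine Finset.sum_congr rfl fun m _ => ?_
    rw [Db_chr, ← Finset.sum_neg_distrib, Finset.mul_sum, Finset.mul_sum, ← Finset.sum_neg_distrib]
    exact Finset.sum_congr rfl fun t _ => by ring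
  rw [this, sum_swap_inner, sum_swap_pairs]
  simp only [Finset.mul_sum]

/-- The sign comes from R^p_{ma b̄} = -∂̄_b Γ_{am}^p. The unbarred slots of `low` meet the
derivatives of f, its barred slots those of h. -/
lemma BR_eq_pair (f h : R) : K.BR f h =
    -K.pair2 (fun b t => K.pair2 (K.covb2 f) fun a m => K.low a m b t) (K.cov2 h) := by
  rw [BR, sum_swap_inner, sum_swap_pairs]
  conv_rhs => rw [pair2_eq, sum_swap_pairs]
  simp only [← Finset.sum_neg_distrib]
  refine Finset.sum_congr rfl fun k _ => Finset.sum_congr rfl fun p _ => ?_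
  calc ∑ l, ∑ q, K.curvUp l k q p * K.covb2 f l q * K.cov2 h k p
      = ∑ l, ∑ q, ∑ b, ∑ t, -(K.gi b k * K.gi t p * ((∑ a, ∑ m, K.gi l a * K.gi q m
          * (K.covb2 f l q * K.low a m b t)) * K.cov2 h k p)) := by
        refine Finset.sum_congr rfl fun l _ => Finset.sum_congr rfl fun q _ => ?_
        rw [curvUp_eq, neg_mul, neg_mul]
        simp only [Finset.sum_neg_distrib, Finset.sum_mul]
        congr 1
        refine Finset.sum_congr rfl fun b _ => Finset.sum_congr rfl fun t _ => ?_
        simp only [Finset.mul_sum, Finset.sum_mul]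
        exact Finset.sum_congr rfl fun a _ => Finset.sum_congr rfl fun m _ => by ring
    _ = _ := by
        rw [sum_swap_pairs]
        refine Finset.sum_congr rfl fun b _ => Finset.sum_congr rfl fun t _ => ?_
        simp only [pair2_eq, Finset.sum_neg_distrib, Finset.sum_mul, Finset.mul_sum]

lemma covb2_mul (a f : R) (l q : ι) : K.covb2 (a * f) l q =
    a * K.covb2 f l q + K.Db l a * K.Db q f + K.Db q a * K.Db l f + K.covb2 a l q * f := by
  have : ∑ m, K.chrb q l m * K.Db m (a * f)
      = a * ∑ m, K.chrb q l m * K.Db m f + (∑ m, K.chrb q l m * K.Db m a) * f := by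
    rw [Finset.mul_sum, Finset.sum_mul, ← Finset.sum_add_distrib]
    refine Finset.sum_congr rfl fun m _ => ?_
    simp only [Derivation.leibniz, smul_eq_mul]; ring
  simp only [covb2, this]
  simp only [Derivation.leibniz, smul_eq_mul, map_add]; ring

/-- Since a has no second barred covariant derivatives, Leibniz leaves only terms with at most one
derivative on a, one for each choice of index. Both ∂_kΦ and holomorphic functions satisfy the
hypothesis. -/
lemma covb3_mul (a f : R) (ha : ∀ l q, K.covb2 a l q = 0) (l q t : ι) : K.covb3 (a * f) l q t =
    a * K.covb3 f l q t + K.Db t a * K.covb2 f l q + K.Db l a * K.covb2 f q t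
      + K.Db q a * K.covb2 f l t := by
  have hd : ∀ l q, K.Db q (K.Db l a) = ∑ m, K.chrb q l m * K.Db m a := fun l q =>
    sub_eq_zero.mp (ha l q)
  have hf : ∀ l q, K.Db q (K.Db l f) = K.covb2 f l q + ∑ m, K.chrb q l m * K.Db m f := fun l q => by
    simp [covb2]
  have h2 : ∀ l q, K.covb2 (a * f) l q =
      a * K.covb2 f l q + K.Db l a * K.Db q f + K.Db q a * K.Db l f := fun l q => by
    rw [covb2_mul, ha, zero_mul, add_zero]
  have s1 : ∀ l q, ∑ m, K.chrb t l m * K.covb2 (a * f) m q =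
      a * ∑ m, K.chrb t l m * K.covb2 f m q + (∑ m, K.chrb t l m * K.Db m a) * K.Db q f
        + K.Db q a * ∑ m, K.chrb t l m * K.Db m f := fun l q => by
    simp only [Finset.mul_sum, Finset.sum_mul, ← Finset.sum_add_distrib]
    refine Finset.sum_congr rfl fun m _ => ?_
    rw [h2]; ring
  have s2 := s1 q l
  simp only [K.covb2_symm _ _ l] at s2
  rw [covb3, covb3, s1, s2, h2]
  simp only [map_add, Derivation.leibniz, smul_eq_mul, hd, hf]; ring

lemma Db_D_pot (k l : ι) : K.Db l (K.D k K.pot) = K.g k l := (K.D_Db k l _).symm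

lemma covb2_D_pot (k l q : ι) : K.covb2 (K.D k K.pot) l q = 0 := by
  simp only [covb2, Db_D_pot, sum_chrb_g, sub_self]

lemma covb2_of_Db_eq_zero {a : R} (ha : ∀ l, K.Db l a = 0) (l q : ι) : K.covb2 a l q = 0 := by
  simp [covb2, ha]

lemma covb3_of_Db_eq_zero {a : R} (ha : ∀ l, K.Db l a = 0) (l q t : ι) : K.covb3 a l q t = 0 := by
  simp [covb3, K.covb2_of_Db_eq_zero ha]

lemma B1_D_pot_mul (k : ι) (f h : R) :
    K.B1 (K.D k K.pot * f) h = K.D k K.pot * K.B1 f h + f * K.D k h := by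
  simp only [B1_eq_pair, Derivation.leibniz, smul_eq_mul, Db_D_pot, pair_add_left, pair_mul_left]
  rw [pair_g]

/-- The two Leibniz cross terms put k into the first or the second slot of the Hessian of h; its
symmetry makes them equal, hence the factor 2. -/
lemma B2_D_pot_mul (k : ι) (f h : R) : K.B2 (K.D k K.pot * f) h =
    K.D k K.pot * K.B2 f h + 2 * K.pair (K.Db · f) (K.cov2 h k) := by
  have : K.covb2 (K.D k K.pot * f) = fun l q => K.D k K.pot * K.covb2 f l q
      + K.g k l * K.Db q f + K.Db l f * K.g k q := by
    funext l q; rw [covb2_mul, covb2_D_pot, Db_D_pot, Db_D_pot]; ring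
  rw [B2_eq_pair, this, pair2_add_left, pair2_add_left, pair2_mul_left,
    K.pair2_g_left k (K.Db · f), K.pair2_g_right k (K.Db · f), B2_eq_pair]
  simp only [K.cov2_symm h _ k]; ring

/-- There are three cross terms, with k in each of the three slots of h; total symmetry of the third
covariant derivative merges them. -/
lemma B3_D_pot_mul (k : ι) (f h : R) : K.B3 (K.D k K.pot * f) h =
    K.D k K.pot * K.B3 f h + 3 * K.pair2 (K.covb2 f) fun m p => K.cov3 h m p k := by
  have : K.covb3 (K.D k K.pot * f) = fun l q t => K.D k K.pot * K.covb3 f l q t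
      + K.g k t * K.covb2 f l q + K.g k l * K.covb2 f q t + K.g k q * K.covb2 f l t := by
    funext l q t
    rw [covb3_mul _ _ _ (K.covb2_D_pot k), Db_D_pot, Db_D_pot, Db_D_pot]
  rw [B3_eq_pair, this, pair3_add_left, pair3_add_left, pair3_add_left, pair3_mul_left,
    pair3_g_left, pair3_g_middle, pair3_g_right, B3_eq_pair]
  have h1 : K.cov3 h k = fun m p => K.cov3 h m p k := by
    funext m p; rw [cov3_symm_left, cov3_symm_right]
  have h2 : (fun m => K.cov3 h m k) = fun m p => K.cov3 h m p k := by
    funext m p; rw [cov3_symm_right]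
  rw [h1, h2]; ring

/-- The contraction of the curvature with `φ_{/l̄}` and `ψ_{/kp}` which measures the failure of
`∂_k` to commute with the contraction of second covariant derivatives. -/
def curvTerm (k : ι) (f h : R) : R :=
  K.pair2 (fun b t => K.pair (K.Db · f) fun m => K.low k m b t) (K.cov2 h)

/-- The 2 counts the equal cross terms, by symmetry of the curvature; the minus sign is that of
`BR_eq_pair`. -/
lemma BR_D_pot_mul (k : ι) (f h : R) : K.BR (K.D k K.pot * f) h =
    K.D k K.pot * K.BR f h - 2 * K.curvTerm k f h := by
  have : K.covb2 (K.D k K.pot * f) = fun l q => K.D k K.pot * K.covb2 f l q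
      + K.g k l * K.Db q f + K.Db l f * K.g k q := by
    funext l q; rw [covb2_mul, covb2_D_pot, Db_D_pot, Db_D_pot]; ring
  rw [BR_eq_pair, this]
  simp only [pair2_add_left, pair2_mul_left, K.pair2_g_left k (K.Db · f),
    K.pair2_g_right k (K.Db · f), K.low_symm_left _ k]
  rw [BR_eq_pair, curvTerm]; ring

lemma sum_D_gi_mul (k l : ι) (Y : ι → R) :
    ∑ m, K.D k (K.gi l m) * Y m = -∑ m, K.gi l m * ∑ a, K.chr k m a * Y a := by
  simp only [D_gi, neg_mul, Finset.sum_neg_distrib, Finset.sum_mul, Finset.mul_sum, mul_assoc]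
  rw [Finset.sum_comm]

/-- Since ∂_k g⁻¹ = -g⁻¹Γ, with Γ acting on the unbarred index only, ∂_k acts on barred slots as a
plain derivative and on unbarred slots as a covariant one. -/
lemma D_pair (k : ι) (F H : ι → R) : K.D k (K.pair F H) =
    K.pair (fun l => K.D k (F l)) H
      + K.pair F fun m => K.D k (H m) - ∑ a, K.chr k m a * H a := by
  have : K.D k (K.pair F H) = K.pair (fun l => K.D k (F l)) H + K.pair F (fun m => K.D k (H m))
      + ∑ l, F l * ∑ m, K.D k (K.gi l m) * H m := by
    simp only [pair, map_sum, Derivation.leibniz, smul_eq_mul, Finset.mul_sum,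
      ← Finset.sum_add_distrib]
    exact Finset.sum_congr rfl fun l _ => Finset.sum_congr rfl fun m _ => by ring
  rw [this, pair_sub_right]
  simp only [sum_D_gi_mul, mul_neg, Finset.sum_neg_distrib]
  simp only [pair, Finset.mul_sum, mul_left_comm]
  ring

lemma sum_mul_pair_right (F : ι → R) (c : ι → R) (H : ι → ι → R) :
    ∑ a, c a * K.pair F (H a) = K.pair F fun p => ∑ a, c a * H a p := by
  simp only [pair, Finset.mul_sum]
  rw [Finset.sum_comm]
  refine Finset.sum_congr rfl fun l _ => ?_
  rw [Finset.sum_comm]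
  exact Finset.sum_congr rfl fun k _ => Finset.sum_congr rfl fun a _ => by ring

lemma D_pair2 (k : ι) (F H : ι → ι → R) : K.D k (K.pair2 F H) =
    K.pair2 (fun l q => K.D k (F l q)) H
      + K.pair2 F fun m p => K.D k (H m p) - ∑ a, K.chr k m a * H a p
        - ∑ a, K.chr k p a * H m a := by
  have : K.D k (K.pair2 F H) = (∑ l, ∑ m, K.gi l m * K.D k (K.pair (F l) (H m)))
      + ∑ l, ∑ m, K.D k (K.gi l m) * K.pair (F l) (H m) := by
    simp only [pair2, map_sum, Derivation.leibniz, smul_eq_mul, ← Finset.sum_add_distrib]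
    exact Finset.sum_congr rfl fun l _ => Finset.sum_congr rfl fun m _ => by ring
  rw [this]
  simp only [sum_D_gi_mul, D_pair, pair2_sub_right]
  simp only [sum_mul_pair_right, pair2, pair_sub_right, mul_add, mul_sub, Finset.sum_add_distrib,
    Finset.sum_sub_distrib, Finset.sum_neg_distrib]
  ring

lemma D_B1 (k : ι) (f h : R) :
    K.D k (K.B1 f h) = K.B1 (K.D k f) h + K.pair (K.Db · f) (K.cov2 h k) := by
  simp only [B1_eq_pair, D_pair, K.D_Db]
  rw [show K.cov2 h k = fun m => K.cov2 h m k from funext fun m => K.cov2_symm h k m]; rfl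

/-- The commutator of ∂_k with the barred Hessian comes entirely from ∂_k Γ̄, which is curvature. -/
lemma D_covb2 (k : ι) (f : R) (l q : ι) : K.D k (K.covb2 f l q) =
    K.covb2 (K.D k f) l q + -K.pair (K.Db · f) fun s => K.low k s l q := by
  have e : K.pair (K.Db · f) (fun s => K.low k s l q) = ∑ m, K.D k (K.chrb q l m) * K.Db m f := by
    simp only [pair, D_chrb, Finset.sum_mul, K.low_symm_right k _ q l]
    exact Finset.sum_congr rfl fun m _ => Finset.sum_congr rfl fun s _ => by ring
  rw [e]
  simp only [covb2, map_sub, map_sum, Derivation.leibniz, smul_eq_mul, K.D_Db,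
    Finset.sum_add_distrib, mul_comm (K.Db _ f)]
  ring

lemma D_B2 (k : ι) (f h : R) : K.D k (K.B2 f h) = K.B2 (K.D k f) h
    + K.pair2 (K.covb2 f) (fun m p => K.cov3 h m p k) - K.curvTerm k f h := by
  simp only [B2_eq_pair, D_pair2, D_covb2, pair2_add_left, pair2_neg_left]
  simp only [cov3, curvTerm]; ring

/-- The Christoffel terms are absorbed crosswise into derivatives of the inverse metric: those of f
into ∂̄_l g^{q̄p}, those of h into ∂_p g^{l̄k}. -/
lemma B2_eq_coordinates (f h : R) : K.B2 f h = ∑ l, ∑ k, ∑ q, ∑ p,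
    (K.gi q p * K.gi l k * K.Db l (K.Db q f) * K.D k (K.D p h)
      + K.gi q p * K.D p (K.gi l k) * K.Db l (K.Db q f) * K.D k h
      + K.Db l (K.gi q p) * K.gi l k * K.Db q f * K.D k (K.D p h)
      + K.Db l (K.gi q p) * K.D p (K.gi l k) * K.Db q f * K.D k h) := by
  have hY : ∀ l p, ∑ q, K.gi q p * K.covb2 f l q
      = ∑ q, (K.gi q p * K.Db l (K.Db q f) + K.Db l (K.gi q p) * K.Db q f) := fun l p => by
    have e : ∀ q, K.covb2 f l q = K.Db l (K.Db q f) - ∑ m, K.chrb l q m * K.Db m f :=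
      fun q => K.covb2_symm f l q
    simp only [e, mul_sub, Finset.sum_add_distrib, Finset.sum_sub_distrib,
      Db_gi, neg_mul, Finset.sum_neg_distrib, Finset.mul_sum, Finset.sum_mul]
    rw [sub_eq_add_neg]
    congr 2; clear e
    rw [Finset.sum_comm]
    exact Finset.sum_congr rfl fun m _ => Finset.sum_congr rfl fun q _ => by ring
  have hZ : ∀ l p, ∑ k, K.gi l k * K.cov2 h k p
      = ∑ k, (K.gi l k * K.D k (K.D p h) + K.D p (K.gi l k) * K.D k h) := fun l p => by
    simp only [Finset.sum_add_distrib, sum_D_gi_mul, cov2, mul_sub, Finset.sum_sub_distrib,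
      K.D_comm p, ← sub_eq_add_neg]
  -- For fixed l and p the sum over q involves only f and the sum over k only h, so the two
  -- replacements are independent.
  have arrange : ∀ Y Z : ι → ι → ι → R, ∑ l, ∑ k, ∑ q, ∑ p, Y l q p * Z l k p
      = ∑ l, ∑ p, (∑ q, Y l q p) * ∑ k, Z l k p := fun Y Z => by
    refine Finset.sum_congr rfl fun l _ => ?_
    simp only [Finset.mul_sum, Finset.sum_mul]
    conv_lhs => enter [2, k]; rw [Finset.sum_comm]
    rw [Finset.sum_comm]
  calc K.B2 f h = ∑ l, ∑ k, ∑ q, ∑ p, (K.gi q p * K.covb2 f l q) * (K.gi l k * K.cov2 h k p) := by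
        rw [B2]
        exact Finset.sum_congr rfl fun l _ => Finset.sum_congr rfl fun k _ =>
          Finset.sum_congr rfl fun q _ => Finset.sum_congr rfl fun p _ => by ring
    _ = ∑ l, ∑ k, ∑ q, ∑ p, (K.gi q p * K.Db l (K.Db q f) + K.Db l (K.gi q p) * K.Db q f)
        * (K.gi l k * K.D k (K.D p h) + K.D p (K.gi l k) * K.D k h) := by
        rw [arrange (fun l q p => K.gi q p * K.covb2 f l q) fun l k p => K.gi l k * K.cov2 h k p,
          arrange (fun l q p => K.gi q p * K.Db l (K.Db q f) + K.Db l (K.gi q p) * K.Db q f)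
            fun l k p => K.gi l k * K.D k (K.D p h) + K.D p (K.gi l k) * K.D k h]
        simp only [hY, hZ]
    _ = _ := Finset.sum_congr rfl fun l _ => Finset.sum_congr rfl fun k _ =>
          Finset.sum_congr rfl fun q _ => Finset.sum_congr rfl fun p _ => by ring

end KahlerAlgebra
end KahlerStar

/-! ### The recursion for the coefficients and its unique solution -/

namespace KahlerStar
namespace KahlerAlgebra

variable {ι R : Type*} [Fintype ι] [DecidableEq ι] [CommRing R] [Algebra ℂ R]
  (K : KahlerAlgebra ι R)

lemma B1_add_left (f f' h : R) : K.B1 (f + f') h = K.B1 f h + K.B1 f' h := by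
  simp only [B1_eq_pair, map_add, pair_add_left]

lemma covb2_add (f f' : R) : K.covb2 (f + f') = fun l q => K.covb2 f l q + K.covb2 f' l q := by
  funext l q; simp only [covb2, map_add, mul_add, Finset.sum_add_distrib]; ring

lemma covb3_add (f f' : R) :
    K.covb3 (f + f') = fun l q t => K.covb3 f l q t + K.covb3 f' l q t := by
  funext l q t; simp only [covb3, covb2_add, map_add, mul_add, Finset.sum_add_distrib]; ring

lemma B2_add_left (f f' h : R) : K.B2 (f + f') h = K.B2 f h + K.B2 f' h := by
  simp only [B2_eq_pair, covb2_add, pair2_add_left]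

lemma B3_add_left (f f' h : R) : K.B3 (f + f') h = K.B3 f h + K.B3 f' h := by
  simp only [B3_eq_pair, covb3_add, pair3_add_left]

lemma BR_add_left (f f' h : R) : K.BR (f + f') h = K.BR f h + K.BR f' h := by
  simp only [BR_eq_pair, covb2_add, pair2_add_left]; ring

section Holomorphic

variable {a : R} (ha : ∀ l, K.Db l a = 0)
include ha

lemma B1_mul_left (f h : R) : K.B1 (a * f) h = a * K.B1 f h := by
  simp only [B1_eq_pair, Derivation.leibniz, smul_eq_mul, ha, mul_zero, add_zero, pair_mul_left]

lemma covb2_mul_left (f : R) : K.covb2 (a * f) = fun l q => a * K.covb2 f l q := by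
  funext l q; rw [covb2_mul, K.covb2_of_Db_eq_zero ha, ha, ha]; ring

lemma B2_mul_left (f h : R) : K.B2 (a * f) h = a * K.B2 f h := by
  rw [B2_eq_pair, K.covb2_mul_left ha, pair2_mul_left, B2_eq_pair]

lemma B3_mul_left (f h : R) : K.B3 (a * f) h = a * K.B3 f h := by
  have : K.covb3 (a * f) = fun l q t => a * K.covb3 f l q t := by
    funext l q t; rw [covb3_mul _ _ _ (K.covb2_of_Db_eq_zero ha), ha, ha, ha]; ring
  rw [B3_eq_pair, this, pair3_mul_left, B3_eq_pair]

lemma BR_mul_left (f h : R) : K.BR (a * f) h = a * K.BR f h := by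
  simp only [BR_eq_pair, K.covb2_mul_left ha, pair2_mul_left]; ring

end Holomorphic

lemma B1_one (h : R) : K.B1 1 h = 0 := by simp [B1]

lemma covb2_one (l q : ι) : K.covb2 1 l q = 0 := K.covb2_of_Db_eq_zero (by simp) l q

lemma B2_one (h : R) : K.B2 1 h = 0 := by simp [B2, covb2_one]

lemma B3_one (h : R) : K.B3 1 h = 0 := by
  have : ∀ l q t, K.covb3 1 l q t = 0 := K.covb3_of_Db_eq_zero (by simp)
  simp [B3, this]

lemma BR_one (h : R) : K.BR 1 h = 0 := by simp [BR, covb2_one]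

/-- The points at which every `f` has a first-order expansion
`f = f(x) + ∑ (z^k - z^k(x)) a_k + ∑ (∂_kΦ - ∂_kΦ(x)) b_k`. -/
def HasExpansion (z : ι → R) (ev : R →ₐ[ℂ] ℂ) : Prop :=
  ∀ f, ∃ a b : ι → R, f = algebraMap ℂ R (ev f)
    + ∑ k, (z k - algebraMap ℂ R (ev (z k))) * a k
    + ∑ k, (K.D k K.pot - algebraMap ℂ R (ev (K.D k K.pot))) * b k

/-- Apply A to the first-order expansion of f: the constant is killed, and the other terms keep
their factors vanishing at the point. -/
lemma ev_eq_zero_of_commute {z : ι → R} {ev : R →ₐ[ℂ] ℂ} (hev : K.HasExpansion z ev)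
    (A : R → R) (hadd : ∀ f f', A (f + f') = A f + A f') (h1 : A 1 = 0)
    (hc : ∀ c f, A (algebraMap ℂ R c * f) = algebraMap ℂ R c * A f)
    (hz : ∀ k f, A (z k * f) = z k * A f)
    (hu : ∀ k f, A (K.D k K.pot * f) = K.D k K.pot * A f) (f : R) : ev (A f) = 0 := by
  let A' : R →+ R := AddMonoidHom.mk' A hadd
  have hA' : ∀ f, A' f = A f := fun _ => rfl
  obtain ⟨a, b, hf⟩ := hev f
  have hA : A f = A' f := rfl
  rw [hA, hf, map_add, map_add, map_sum, map_sum]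
  have e0 : A' (algebraMap ℂ R (ev f)) = 0 := by
    rw [← mul_one (algebraMap ℂ R (ev f)), hA', hc, h1, mul_zero]
  have e1 : ∀ k, ev (A' ((z k - algebraMap ℂ R (ev (z k))) * a k)) = 0 := fun k => by
    rw [sub_mul, map_sub, hA', hA', hz, hc, ← sub_mul, map_mul]; simp
  have e2 : ∀ k, ev (A' ((K.D k K.pot - algebraMap ℂ R (ev (K.D k K.pot))) * b k)) = 0 :=
    fun k => by rw [sub_mul, map_sub, hA', hA', hu, hc, ← sub_mul, map_mul]; simp
  simp [e0, e1, e2]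

/-- A family of bilinear operators satisfying the defining properties of the standard
star-product with separation of variables. -/
structure IsStdStar (z : ι → R) (c : ℕ → R → R → R) : Prop where
  add_left : ∀ r f f' h, c r (f + f') h = c r f h + c r f' h
  zeroth : ∀ f h, c 0 f h = f * h
  one_left : ∀ r h, c (r + 1) 1 h = 0
  assoc : ∀ r f f' h, ∑ a ∈ Finset.HasAntidiagonal.antidiagonal r, c a.1 (c a.2 f f') h =
    ∑ a ∈ Finset.HasAntidiagonal.antidiagonal r, c a.1 f (c a.2 f' h)
  const : ∀ r (a : ℂ) h, c (r + 1) (algebraMap ℂ R a) h = 0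
  coord : ∀ r k h, c (r + 1) (z k) h = 0
  pot_one : ∀ k h, c 1 (K.D k K.pot) h = K.D k h
  pot : ∀ r k h, c (r + 2) (K.D k K.pot) h = 0

namespace IsStdStar

variable {K} {z : ι → R} {c : ℕ → R → R → R} (hc : K.IsStdStar z c)
include hc

lemma zero_left (r : ℕ) (h : R) : c r 0 h = 0 := by
  have := hc.add_left r 0 0 h; simpa using this

/-- The coefficient of ν^(r+1) in a ∗ (f' ∗ h), when left multiplication by a stops at order ν. -/
lemma sum_antidiagonal (r : ℕ) (a f' h : R) (ha : ∀ r h, c (r + 2) a h = 0) :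
    ∑ x ∈ Finset.HasAntidiagonal.antidiagonal (r + 1), c x.1 a (c x.2 f' h)
      = a * c (r + 1) f' h + c 1 a (c r f' h) := by
  rw [Finset.Nat.sum_antidiagonal_succ, Finset.Nat.sum_antidiagonal_eq_sum_range_succ_mk,
    Finset.sum_range_succ']
  simp [ha, hc.zeroth]

lemma sum_antidiagonal' (r : ℕ) (a f' h : R) (ha : ∀ r h, c (r + 2) a h = 0) :
    ∑ x ∈ Finset.HasAntidiagonal.antidiagonal (r + 1), c x.1 (c x.2 a f') h
      = c (r + 1) (a * f') h + c r (c 1 a f') h := by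
  rw [Finset.Nat.sum_antidiagonal_eq_sum_range_succ_mk, Finset.sum_range_succ,
    Finset.sum_range_succ]
  -- For i < r the inner order r + 1 - i is at least 2, where a contributes nothing.
  have : ∀ i ∈ Finset.range r, c i (c (r + 1 - i) a f') h = 0 := fun i hi => by
    obtain ⟨j, hj⟩ := Nat.exists_eq_add_of_lt (Finset.mem_range.mp hi)
    rw [show r + 1 - i = j + 2 by omega, ha, hc.zero_left]
  simp [Finset.sum_eq_zero this, hc.zeroth, add_comm]

/-- When a star-multiplies from the left as a plain factor, associativity lets it pass through. -/
lemma mul_left {a : R} (ha : ∀ r h, c (r + 1) a h = 0) (r : ℕ) (f h : R) :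
    c (r + 1) (a * f) h = a * c (r + 1) f h := by
  have := hc.assoc (r + 1) a f h
  rw [hc.sum_antidiagonal r a f h fun r => ha (r + 1),
    hc.sum_antidiagonal' r a f h fun r => ha (r + 1), ha 0, ha 0, hc.zero_left] at this
  simpa using this

/-- The coefficient of ν^(r+1) in (u ∗ f) ∗ h = u ∗ (f ∗ h), where u = ∂_kΦ acts from the left as u
+ ν∂_k. -/
lemma D_pot_mul (r : ℕ) (k : ι) (f h : R) : c (r + 1) (K.D k K.pot * f) h
    = K.D k K.pot * c (r + 1) f h + K.D k (c r f h) - c r (K.D k f) h := by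
  have := hc.assoc (r + 1) (K.D k K.pot) f h
  rw [hc.sum_antidiagonal r _ f h fun r => hc.pot r k,
    hc.sum_antidiagonal' r _ f h fun r => hc.pot r k, hc.pot_one, hc.pot_one] at this
  exact eq_sub_of_add_eq this

/-- An operator satisfying the recursion for `c (r + 1)` coincides with it. -/
lemma eq_of_recursion {X : Type*} {ev : X → R →ₐ[ℂ] ℂ} (hev : ∀ x, K.HasExpansion z (ev x))
    (hinj : ∀ f, (∀ x, ev x f = 0) → f = 0) (r : ℕ) (B : R → R → R)
    (hz : ∀ k l, K.Db l (z k) = 0)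
    (hadd : ∀ f f' h, B (f + f') h = B f h + B f' h) (h1 : ∀ h, B 1 h = 0)
    (hmul : ∀ a, (∀ l, K.Db l a = 0) → ∀ f h, B (a * f) h = a * B f h)
    (hpot : ∀ k f h, B (K.D k K.pot * f) h
      = K.D k K.pot * B f h + K.D k (c r f h) - c r (K.D k f) h) (f h : R) :
    c (r + 1) f h = B f h := by
  rw [← sub_eq_zero]
  refine hinj _ fun x => K.ev_eq_zero_of_commute (hev x) (fun f => c (r + 1) f h - B f h)
    ?_ ?_ ?_ ?_ ?_ f
  · intro f f'; simp only [hc.add_left, hadd]; ring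
  · simp only [hc.one_left, h1, sub_zero]
  · intro a f
    simp only [hc.mul_left fun r => hc.const r a, hmul _ (fun l => (K.Db l).map_algebraMap a)]
    ring
  · intro k f; simp only [hc.mul_left fun r => hc.coord r k, hmul _ (hz k)]; ring
  · intro k f; simp only [hc.D_pot_mul, hpot]; ring

variable {X : Type*} {ev : X → R →ₐ[ℂ] ℂ} (hev : ∀ x, K.HasExpansion z (ev x))
  (hinj : ∀ f, (∀ x, ev x f = 0) → f = 0) (hz : ∀ k l, K.Db l (z k) = 0)
include hev hinj hz

theorem first_eq (f h : R) : c 1 f h = K.B1 f h :=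
  hc.eq_of_recursion hev hinj 0 K.B1 hz K.B1_add_left K.B1_one (fun _ ha => K.B1_mul_left ha)
    -- At order zero the product is pointwise, so the inhomogeneous term is ∂_k(f h) - (∂_k f) h = f
    -- ∂_k h.
    (fun k f h => by
      rw [B1_D_pot_mul, hc.zeroth, hc.zeroth, Derivation.leibniz, smul_eq_mul, smul_eq_mul]; ring)
    f h

theorem second_eq (f h : R) : c 2 f h = (1 / 2 : ℂ) • K.B2 f h := by
  refine hc.eq_of_recursion hev hinj 1 (fun f h => (1 / 2 : ℂ) • K.B2 f h) hz ?_ ?_ ?_ ?_ f h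
  · intro f f' h; simp only [B2_add_left, smul_add]
  · intro h; simp only [B2_one, smul_zero]
  · intro a ha f h; simp only [K.B2_mul_left ha, mul_smul_comm]
  · intro k f h
    simp only [hc.first_eq hev hinj hz, B2_D_pot_mul, D_B1, two_mul, smul_add, mul_smul_comm]
    module

theorem third_eq (f h : R) :
    c 3 f h = (1 / 6 : ℂ) • K.B3 f h + (1 / 4 : ℂ) • K.BR f h := by
  refine hc.eq_of_recursion hev hinj 2
    (fun f h => (1 / 6 : ℂ) • K.B3 f h + (1 / 4 : ℂ) • K.BR f h) hz ?_ ?_ ?_ ?_ f h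
  · intro f f' h; simp only [B3_add_left, BR_add_left]; module
  · intro h; simp only [B3_one, BR_one, smul_zero, add_zero]
  · intro a ha f h; simp only [K.B3_mul_left ha, K.BR_mul_left ha, mul_add, mul_smul_comm]
  -- With the factor 1/2 of C_2, the required term is half of the third-derivative contraction minus
  -- half of `curvTerm`; these come from 3/6 and -2/4 respectively.
  · intro k f h
    simp only [hc.second_eq hev hinj hz, B3_D_pot_mul, BR_D_pot_mul, Derivation.map_smul, D_B2,
      two_mul, mul_add, mul_smul_comm, show (3 : R) = 1 + 1 + 1 by norm_num, add_mul, one_mul]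
    module

end IsStdStar
end KahlerAlgebra
end KahlerStar

/-! ### Averages along segments and Hadamard's lemma -/

noncomputable section

namespace KahlerStar

section Average

variable {V : Type} [NormedAddCommGroup V] [NormedSpace ℝ V]

lemma segment_point_mem {B : Set V} (hc : Convex ℝ B) {y z : V} (hy : y ∈ B) (hz : z ∈ B) {t : ℝ}
    (ht : t ∈ Set.Icc (0 : ℝ) 1) : y + t • (z - y) ∈ B :=
  hc.add_smul_sub_mem hy hz ht

lemma continuousOn_comp_segment {E : Type*} [TopologicalSpace E] {B : Set V} (hc : Convex ℝ B)
    {G : V → E} (hG : ContinuousOn G B) {y z : V} (hy : y ∈ B) (hz : z ∈ B) :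
    ContinuousOn (fun t : ℝ => G (y + t • (z - y))) (Set.uIcc 0 1) := by
  rw [Set.uIcc_of_le zero_le_one]
  exact hG.comp (by fun_prop) fun t ht => segment_point_mem hc hy hz ht

variable [ProperSpace V]

lemma hasFDerivAt_weighted_average {E : Type*} [NormedAddCommGroup E] [NormedSpace ℝ E]
    {B : Set V} (hB : IsOpen B) (hc : Convex ℝ B) {y : V} (hy : y ∈ B) {G : V → E}
    (hG : ContDiffOn ℝ 1 G B) {w : ℝ → ℝ} (hw : Continuous w) {z₀ : V} (hz₀ : z₀ ∈ B) :
    HasFDerivAt (fun z => ∫ t in (0 : ℝ)..1, w t • G (y + t • (z - y)))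
      (∫ t in (0 : ℝ)..1, (w t * t) • fderiv ℝ G (y + t • (z₀ - y))) z₀ := by
  have hG' : ContinuousOn (fderiv ℝ G) B := hG.continuousOn_fderiv_of_isOpen hB le_rfl
  obtain ⟨ε, hε, hεB⟩ := Metric.nhds_basis_closedBall.mem_iff.mp (hB.mem_nhds hz₀)
  -- The segments from y to a closed ball around z₀ sweep out a compact subset of B, which gives a
  -- uniform bound on the derivative for dominated convergence.
  have hcomp : IsCompact ((fun p : ℝ × V => y + p.1 • (p.2 - y)) ''
      (Set.Icc 0 1 ×ˢ Metric.closedBall z₀ ε)) :=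
    (isCompact_Icc.prod (isCompact_closedBall z₀ ε)).image (by fun_prop)
  have hsub : (fun p : ℝ × V => y + p.1 • (p.2 - y)) ''
      (Set.Icc 0 1 ×ˢ Metric.closedBall z₀ ε) ⊆ B := by
    rintro _ ⟨p, hp, rfl⟩
    exact segment_point_mem hc hy (hεB hp.2) hp.1
  obtain ⟨C, hC⟩ := hcomp.exists_bound_of_continuousOn (hG'.mono hsub)
  have hI : ∀ t ∈ Set.uIoc (0 : ℝ) 1, t ∈ Set.Icc (0 : ℝ) 1 := fun t ht => by
    rw [Set.uIoc_of_le zero_le_one] at ht; exact ⟨ht.1.le, ht.2⟩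
  refine intervalIntegral.hasFDerivAt_integral_of_dominated_of_fderiv_le
    (F := fun z t => w t • G (y + t • (z - y)))
    (F' := fun z t => (w t * t) • fderiv ℝ G (y + t • (z - y)))
    (bound := fun t => |w t * t| * C) (Metric.closedBall_mem_nhds z₀ hε) ?_ ?_ ?_ ?_ ?_ ?_
  · filter_upwards [hB.mem_nhds hz₀] with z hz
    exact ((hw.continuousOn.smul (continuousOn_comp_segment hc hG.continuousOn hy hz)).mono
      Set.uIoc_subset_uIcc).aestronglyMeasurable measurableSet_uIoc
  · exact (hw.continuousOn.smul
      (continuousOn_comp_segment hc hG.continuousOn hy hz₀)).intervalIntegrable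
  · exact (((hw.mul continuous_id).continuousOn.smul
      (continuousOn_comp_segment hc hG' hy hz₀)).mono
      Set.uIoc_subset_uIcc).aestronglyMeasurable measurableSet_uIoc
  · refine Filter.Eventually.of_forall fun t ht z hz => ?_
    rw [norm_smul, Real.norm_eq_abs]
    exact mul_le_mul_of_nonneg_left (hC _ ⟨(t, z), ⟨hI t ht, hz⟩, rfl⟩) (abs_nonneg _)
  · exact (((hw.mul continuous_id).abs).mul continuous_const).intervalIntegrable _ _
  · refine Filter.Eventually.of_forall fun t ht z hz => ?_
    have hm := segment_point_mem hc hy (hεB hz) (hI t ht)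
    have h1 : HasFDerivAt G (fderiv ℝ G (y + t • (z - y))) (y + t • (z - y)) :=
      ((hG.differentiableOn one_ne_zero).differentiableAt (hB.mem_nhds hm)).hasFDerivAt
    have h2 : HasFDerivAt (fun z : V => y + t • (z - y)) (t • ContinuousLinearMap.id ℝ V) z :=
      (((hasFDerivAt_id z).sub_const y).const_smul t).const_add y
    have h3 : (w t * t) • fderiv ℝ G (y + t • (z - y)) =
        w t • (fderiv ℝ G (y + t • (z - y))).comp (t • ContinuousLinearMap.id ℝ V) := by
      ext v; simp [mul_smul]
    simp only [h3]
    exact (h1.comp z h2).const_smul (w t)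

/-- Each differentiation under the integral multiplies the weight by t and replaces G by its
derivative, so the induction must run over all weights and all target spaces. -/
lemma contDiffOn_weighted_average {B : Set V} (hB : IsOpen B) (hc : Convex ℝ B) {y : V}
    (hy : y ∈ B) (m : ℕ) : ∀ {E : Type} [NormedAddCommGroup E] [NormedSpace ℝ E] {G : V → E},
    ContDiffOn ℝ ∞ G B → ∀ {w : ℝ → ℝ}, Continuous w →
    ContDiffOn ℝ m (fun z => ∫ t in (0 : ℝ)..1, w t • G (y + t • (z - y))) B := by
  induction m with
  | zero =>
    intro E _ _ G hG w hw
    refine contDiffOn_zero.mpr fun z hz => ?_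
    exact (hasFDerivAt_weighted_average hB hc hy (hG.of_le (mod_cast le_top)) hw
      hz).continuousAt.continuousWithinAt
  | succ m ih =>
    intro E _ _ G hG w hw
    have hd := fun z hz =>
      hasFDerivAt_weighted_average hB hc hy (hG.of_le (mod_cast le_top)) hw (z₀ := z) hz
    rw [Nat.cast_succ]
    refine (contDiffOn_succ_iff_fderiv_of_isOpen hB).mpr
      ⟨fun z hz => (hd z hz).differentiableAt.differentiableWithinAt,
        fun h => absurd h (WithTop.coe_ne_top), ?_⟩
    refine (ih ((contDiffOn_infty_iff_fderiv_of_isOpen hB).mp hG).2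
      (hw.mul continuous_id)).congr fun z hz => (hd z hz).fderiv

lemma contDiffOn_average {B : Set V} (hB : IsOpen B) (hc : Convex ℝ B) {y : V}
    (hy : y ∈ B) {E : Type} [NormedAddCommGroup E] [NormedSpace ℝ E] {G : V → E}
    (hG : ContDiffOn ℝ ∞ G B) :
    ContDiffOn ℝ ∞ (fun z => ∫ t in (0 : ℝ)..1, G (y + t • (z - y))) B := by
  refine contDiffOn_infty.mpr fun m => ?_
  simpa using contDiffOn_weighted_average hB hc hy m hG (w := fun _ => 1) continuous_const

end Average

section Wirtinger

variable {n : ℕ}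

/-- The Wirtinger derivative `∂/∂z^k` on `ℂⁿ`. -/
def dz (k : Fin n) (f : (Fin n → ℂ) → ℂ) : (Fin n → ℂ) → ℂ := fun z =>
  (fderiv ℝ f z (Pi.single k 1) - Complex.I * fderiv ℝ f z (Pi.single k Complex.I)) / 2

/-- The Wirtinger derivative `∂/∂z̄^k` on `ℂⁿ`. -/
def dzb (k : Fin n) (f : (Fin n → ℂ) → ℂ) : (Fin n → ℂ) → ℂ := fun z =>
  (fderiv ℝ f z (Pi.single k 1) + Complex.I * fderiv ℝ f z (Pi.single k Complex.I)) / 2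

lemma contDiffOn_fderiv_apply {B : Set (Fin n → ℂ)} (hB : IsOpen B) {f : (Fin n → ℂ) → ℂ}
    (hf : ContDiffOn ℝ ∞ f B) (v : Fin n → ℂ) :
    ContDiffOn ℝ ∞ (fun z => fderiv ℝ f z v) B :=
  ((contDiffOn_infty_iff_fderiv_of_isOpen hB).mp hf).2.clm_apply contDiffOn_const

lemma contDiffOn_dz {B : Set (Fin n → ℂ)} (hB : IsOpen B) {f : (Fin n → ℂ) → ℂ}
    (hf : ContDiffOn ℝ ∞ f B) (k : Fin n) : ContDiffOn ℝ ∞ (dz k f) B :=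
  ((contDiffOn_fderiv_apply hB hf _).sub
    (contDiffOn_const.mul (contDiffOn_fderiv_apply hB hf _))).div_const 2

lemma contDiffOn_dzb {B : Set (Fin n → ℂ)} (hB : IsOpen B) {f : (Fin n → ℂ) → ℂ}
    (hf : ContDiffOn ℝ ∞ f B) (k : Fin n) : ContDiffOn ℝ ∞ (dzb k f) B :=
  ((contDiffOn_fderiv_apply hB hf _).add
    (contDiffOn_const.mul (contDiffOn_fderiv_apply hB hf _))).div_const 2

lemma dz_congr {B : Set (Fin n → ℂ)} (hB : IsOpen B) {f h : (Fin n → ℂ) → ℂ}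
    (hfh : Set.EqOn f h B) (k : Fin n) : Set.EqOn (dz k f) (dz k h) B := fun z hz => by
  have : f =ᶠ[𝓝 z] h := Filter.eventuallyEq_of_mem (hB.mem_nhds hz) hfh
  simp only [dz, this.fderiv_eq]

lemma dzb_congr {B : Set (Fin n → ℂ)} (hB : IsOpen B) {f h : (Fin n → ℂ) → ℂ}
    (hfh : Set.EqOn f h B) (k : Fin n) : Set.EqOn (dzb k f) (dzb k h) B := fun z hz => by
  have : f =ᶠ[𝓝 z] h := Filter.eventuallyEq_of_mem (hB.mem_nhds hz) hfh
  simp only [dzb, this.fderiv_eq]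

lemma clm_apply_eq_wirtinger (f : (Fin n → ℂ) → ℂ) (z v : Fin n → ℂ) :
    fderiv ℝ f z v = ∑ k, (v k * dz k f z + starRingEnd ℂ (v k) * dzb k f z) := by
  have hv : v = ∑ k, ((v k).re • (Pi.single k 1 : Fin n → ℂ)
      + (v k).im • (Pi.single k Complex.I : Fin n → ℂ)) := by
    have : ∀ k, ((v k).re • (Pi.single k 1 : Fin n → ℂ)
      + (v k).im • (Pi.single k Complex.I : Fin n → ℂ)) = Pi.single k (v k) := fun k => by
      rw [← Pi.single_smul, ← Pi.single_smul, ← Pi.single_add]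
      congr 1; apply Complex.ext <;> simp
    simp only [this]
    exact (Finset.univ_sum_single v).symm
  conv_lhs => rw [hv]
  simp only [map_sum, map_add, map_smul, dz, dzb]
  refine Finset.sum_congr rfl fun k _ => ?_
  have e1 : v k = (v k).re + (v k).im * Complex.I := (Complex.re_add_im _).symm
  have e2 : starRingEnd ℂ (v k) = (v k).re - (v k).im * Complex.I := by
    apply Complex.ext <;> simp
  rw [e2]
  conv_rhs => rw [e1]
  simp only [Complex.real_smul, Complex.add_re, Complex.ofReal_re, Complex.mul_re, Complex.I_re,
    Complex.ofReal_im, Complex.I_im, Complex.add_im, Complex.mul_im, mul_zero, mul_one, sub_zero,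
    add_zero, zero_add]
  linear_combination ((v k).im * fderiv ℝ f z (Pi.single k Complex.I)) * Complex.I_sq

/-- Hadamard's lemma in complex coordinates. -/
lemma hadamard {B : Set (Fin n → ℂ)} (hB : IsOpen B) (hc : Convex ℝ B) {y z : Fin n → ℂ}
    (hy : y ∈ B) (hz : z ∈ B) {f : (Fin n → ℂ) → ℂ} (hf : ContDiffOn ℝ ∞ f B) :
    f z = f y + ∑ k, (z k - y k) * (∫ t in (0 : ℝ)..1, dz k f (y + t • (z - y)))
      + ∑ k, starRingEnd ℂ (z k - y k) * (∫ t in (0 : ℝ)..1, dzb k f (y + t • (z - y))) := by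
  have hInt : ∀ {G : (Fin n → ℂ) → ℂ}, ContDiffOn ℝ ∞ G B →
      IntervalIntegrable (fun t : ℝ => G (y + t • (z - y))) MeasureTheory.volume 0 1 := fun hG =>
    (continuousOn_comp_segment hc hG.continuousOn hy hz).intervalIntegrable
  -- The expansion is the fundamental theorem of calculus on the segment from y to z, with the
  -- differential split into its ∂ and ∂̄ parts.
  have hderiv : ∀ t ∈ Set.uIcc (0 : ℝ) 1, HasDerivAt (fun t : ℝ => f (y + t • (z - y)))
      (∑ k, ((z - y) k * dz k f (y + t • (z - y))
        + starRingEnd ℂ ((z - y) k) * dzb k f (y + t • (z - y)))) t := fun t ht => by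
    rw [Set.uIcc_of_le zero_le_one] at ht
    rw [← clm_apply_eq_wirtinger]
    have hm := segment_point_mem hc hy hz ht
    have h1 : HasFDerivAt f (fderiv ℝ f (y + t • (z - y))) (y + t • (z - y)) :=
      ((hf.differentiableOn (by simp)).differentiableAt (hB.mem_nhds hm)).hasFDerivAt
    have h2 : HasDerivAt (fun t : ℝ => y + t • (z - y)) (z - y) t := by
      simpa using ((hasDerivAt_id t).smul_const (z - y)).const_add y
    exact h1.comp_hasDerivAt t h2
  have ii1 : ∀ k, IntervalIntegrable (fun t : ℝ => (z - y) k * dz k f (y + t • (z - y)))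
      MeasureTheory.volume 0 1 := fun k => (hInt (contDiffOn_dz hB hf k)).const_mul _
  have ii2 : ∀ k, IntervalIntegrable
      (fun t : ℝ => starRingEnd ℂ ((z - y) k) * dzb k f (y + t • (z - y)))
      MeasureTheory.volume 0 1 := fun k => (hInt (contDiffOn_dzb hB hf k)).const_mul _
  have key := intervalIntegral.integral_eq_sub_of_hasDerivAt hderiv (by
    have := IntervalIntegrable.sum Finset.univ fun k _ => (ii1 k).add (ii2 k)
    simpa only [Finset.sum_fn] using this)
  rw [intervalIntegral.integral_finsetSum fun k _ => (ii1 k).add (ii2 k),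
    Finset.sum_congr rfl fun k _ => intervalIntegral.integral_add (ii1 k) (ii2 k)] at key
  simp only [intervalIntegral.integral_const_mul, Finset.sum_add_distrib, one_smul, zero_smul,
    add_zero, add_sub_cancel, Pi.sub_apply] at key
  rw [add_assoc, key]; ring

end Wirtinger

end KahlerStar

end

/-! ### Smooth functions on an open subset of ℂⁿ as an algebra with derivations -/

noncomputable section

namespace KahlerStar

open TopologicalSpace (Opens)

section SmoothAlgebra

variable {n : ℕ} {B : Opens (Fin n → ℂ)}

open Classical in
/-- Extension by zero of a function on an open set. -/
def zeroExt (f : B → ℂ) : (Fin n → ℂ) → ℂ := fun z => if h : z ∈ B then f ⟨z, h⟩ else 0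

lemma zeroExt_apply (f : B → ℂ) {z : Fin n → ℂ} (hz : z ∈ B) : zeroExt f z = f ⟨z, hz⟩ := by
  simp [zeroExt, hz]

lemma zeroExt_eqOn {f : B → ℂ} {F : (Fin n → ℂ) → ℂ} (h : ∀ z : B, f z = F z) :
    Set.EqOn (zeroExt f) F B := fun z hz => by rw [zeroExt_apply f hz, h]

variable (B) in
/-- The algebra of smooth functions on an open subset of `ℂⁿ`. -/
def smoothAlg : Subalgebra ℂ (B → ℂ) where
  carrier := {f | ContDiffOn ℝ ∞ (zeroExt f) B}
  mul_mem' {f h} hf hh := by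
    refine (ContDiffOn.mul hf hh).congr fun z hz => ?_
    simp [zeroExt_apply _ hz]
  add_mem' {f h} hf hh := by
    refine (ContDiffOn.add hf hh).congr fun z hz => ?_
    simp [zeroExt_apply _ hz]
  algebraMap_mem' c :=
    (contDiffOn_const (c := c)).congr fun z hz => by simp [zeroExt_apply _ hz]

/-- The class in `smoothAlg B` of a function which is smooth on `B`. -/
def smk (F : (Fin n → ℂ) → ℂ) (hF : ContDiffOn ℝ ∞ F B) : smoothAlg B :=
  ⟨fun z => F z, hF.congr (zeroExt_eqOn fun _ => rfl)⟩

/-- An element of `smoothAlg B` as a function on `ℂⁿ`. -/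
def sext (f : smoothAlg B) : (Fin n → ℂ) → ℂ := zeroExt f.1

lemma contDiffOn_sext (f : smoothAlg B) : ContDiffOn ℝ ∞ (sext f) B := f.2

lemma sext_smk (F : (Fin n → ℂ) → ℂ) (hF : ContDiffOn ℝ ∞ F B) : Set.EqOn (sext (smk F hF)) F B :=
  zeroExt_eqOn fun _ => rfl

lemma sext_apply (f : smoothAlg B) (z : B) : sext f z = f.1 z := zeroExt_apply f.1 z.2

lemma smk_sext (f : smoothAlg B) : smk (sext f) (contDiffOn_sext f) = f :=
  Subtype.ext (funext fun z => sext_apply f z)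

/-- Evaluation at a point. -/
def evalAt (z : B) : smoothAlg B →ₐ[ℂ] ℂ := (Pi.evalAlgHom ℂ (fun _ : B => ℂ) z).comp (smoothAlg B).val

lemma evalAt_apply (z : B) (f : smoothAlg B) : evalAt z f = f.1 z := rfl

lemma evalAt_smk (z : B) (F : (Fin n → ℂ) → ℂ) (hF : ContDiffOn ℝ ∞ F B) :
    evalAt z (smk F hF) = F z := rfl

lemma smoothAlg_ext {f h : smoothAlg B} (hfh : ∀ z : B, evalAt z f = evalAt z h) : f = h :=
  Subtype.ext (funext hfh)

lemma differentiableAt_sext (f : smoothAlg B) (z : B) : DifferentiableAt ℝ (sext f) z :=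
  ((contDiffOn_sext f).differentiableOn (by simp)).differentiableAt (B.isOpen.mem_nhds z.2)

lemma fderiv_sext_smk {F : (Fin n → ℂ) → ℂ} (hF : ContDiffOn ℝ ∞ F B) (z : B) :
    fderiv ℝ (sext (smk F hF)) z = fderiv ℝ F z :=
  (Filter.eventuallyEq_of_mem (B.isOpen.mem_nhds z.2) (sext_smk F hF)).fderiv_eq

lemma fderiv_sext_of_eqOn {f : smoothAlg B} {F : (Fin n → ℂ) → ℂ} (h : Set.EqOn (sext f) F B)
    (z : B) : fderiv ℝ (sext f) z = fderiv ℝ F z :=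
  (Filter.eventuallyEq_of_mem (B.isOpen.mem_nhds z.2) h).fderiv_eq

/-- The directional derivative as a derivation of `smoothAlg B`. -/
def dirDer (v : Fin n → ℂ) : Derivation ℂ (smoothAlg B) (smoothAlg B) :=
  Derivation.mk'
    { toFun := fun f => smk (fun z => fderiv ℝ (sext f) z v)
        (contDiffOn_fderiv_apply B.isOpen (contDiffOn_sext f) v)
      map_add' := fun f h => smoothAlg_ext fun z => by
        rw [map_add, evalAt_smk, evalAt_smk, evalAt_smk, fderiv_sext_of_eqOn (F := sext f + sext h),
          fderiv_add (differentiableAt_sext f z) (differentiableAt_sext h z)]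
        · rfl
        · exact zeroExt_eqOn fun w => by simp [sext_apply]
      map_smul' := fun c f => smoothAlg_ext fun z => by
        rw [RingHom.id_apply, map_smul, evalAt_smk, evalAt_smk,
          fderiv_sext_of_eqOn (F := c • sext f), fderiv_const_smul_field]
        · rfl
        · exact zeroExt_eqOn fun w => by simp [sext_apply] }
    fun f h => smoothAlg_ext fun z => by
      simp only [LinearMap.coe_mk, AddHom.coe_mk, map_add, map_mul, smul_eq_mul]
      rw [evalAt_smk, evalAt_smk, evalAt_smk, fderiv_sext_of_eqOn (F := sext f * sext h),
        fderiv_mul (differentiableAt_sext f z) (differentiableAt_sext h z)]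
      · simp [evalAt_apply, sext_apply]
      · exact zeroExt_eqOn fun w => by simp [sext_apply]

lemma evalAt_dirDer (v : Fin n → ℂ) (f : smoothAlg B) (z : B) :
    evalAt z (dirDer v f) = fderiv ℝ (sext f) z v := rfl

lemma dirDer_comm (v w : Fin n → ℂ) (f : smoothAlg B) :
    dirDer v (dirDer w f) = dirDer w (dirDer v f) := smoothAlg_ext fun z => by
  have hf : ContDiffAt ℝ ∞ (sext f) z := (contDiffOn_sext f).contDiffAt (B.isOpen.mem_nhds z.2)
  have key : ∀ v w, evalAt z (dirDer v (dirDer w f)) = fderiv ℝ (fderiv ℝ (sext f)) z v w :=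
    fun v w => by
    have e : Set.EqOn (sext (dirDer w f)) (fun z => fderiv ℝ (sext f) z w) B := sext_smk _ _
    rw [evalAt_dirDer, fderiv_sext_of_eqOn e]
    have hd : DifferentiableAt ℝ (fderiv ℝ (sext f)) z :=
      (hf.fderiv_right (m := ∞) (by rw [ENat.coe_top_add_one])).differentiableAt (by simp)
    rw [fderiv_clm_apply hd (differentiableAt_const w)]
    simp
  rw [key, key]
  exact hf.isSymmSndFDerivAt (by
    rw [minSmoothness_of_isRCLikeNormedField]; exact WithTop.coe_le_coe.mpr (le_top (a := (2 : ℕ∞)))) v w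

/-- The derivation `∂/∂z^k` of `smoothAlg B`. -/
def dzDer (k : Fin n) : Derivation ℂ (smoothAlg B) (smoothAlg B) :=
  (1 / 2 : ℂ) • (dirDer (B := B) (Pi.single k 1) - Complex.I • dirDer (B := B) (Pi.single k Complex.I))

/-- The derivation `∂/∂z̄^k` of `smoothAlg B`. -/
def dzbDer (k : Fin n) : Derivation ℂ (smoothAlg B) (smoothAlg B) :=
  (1 / 2 : ℂ) • (dirDer (B := B) (Pi.single k 1) + Complex.I • dirDer (B := B) (Pi.single k Complex.I))

lemma dzDer_comm (k p : Fin n) (f : smoothAlg B) :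
    dzDer k (dzDer p f) = dzDer p (dzDer k f) := by
  simp only [dzDer, Derivation.smul_apply, Derivation.sub_apply, Derivation.map_smul, map_sub,
    dirDer_comm (Pi.single p _)]
  module

lemma dzbDer_comm (k p : Fin n) (f : smoothAlg B) :
    dzbDer k (dzbDer p f) = dzbDer p (dzbDer k f) := by
  simp only [dzbDer, Derivation.smul_apply, Derivation.add_apply, Derivation.map_smul, map_add,
    dirDer_comm (Pi.single p _)]
  module

lemma dzDer_dzbDer (k p : Fin n) (f : smoothAlg B) :
    dzDer k (dzbDer p f) = dzbDer p (dzDer k f) := by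
  simp only [dzDer, dzbDer, Derivation.smul_apply, Derivation.add_apply, Derivation.sub_apply,
    Derivation.map_smul, map_add, map_sub, dirDer_comm (Pi.single p _)]
  module

lemma dzDer_smk (k : Fin n) {F : (Fin n → ℂ) → ℂ} (hF : ContDiffOn ℝ ∞ F B) :
    dzDer k (smk F hF) = smk (dz k F) (contDiffOn_dz B.isOpen hF k) := smoothAlg_ext fun z => by
  simp only [dzDer, Derivation.smul_apply, Derivation.sub_apply, map_smul, map_sub, evalAt_dirDer,
    evalAt_smk, fderiv_sext_smk, dz, smul_eq_mul]
  ring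

lemma dzbDer_smk (k : Fin n) {F : (Fin n → ℂ) → ℂ} (hF : ContDiffOn ℝ ∞ F B) :
    dzbDer k (smk F hF) = smk (dzb k F) (contDiffOn_dzb B.isOpen hF k) := smoothAlg_ext fun z => by
  simp only [dzbDer, Derivation.smul_apply, Derivation.add_apply, map_smul, map_add, evalAt_dirDer,
    evalAt_smk, fderiv_sext_smk, dzb, smul_eq_mul]
  ring

lemma contDiffOn_coord (k : Fin n) {s : Set (Fin n → ℂ)} :
    ContDiffOn ℝ ∞ (fun z : Fin n → ℂ => z k) s :=
  (ContinuousLinearMap.proj (R := ℝ) (φ := fun _ : Fin n => ℂ) k).contDiff.contDiffOn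

variable (B) in
/-- The coordinate functions. -/
def coord (k : Fin n) : smoothAlg B := smk (fun z => z k) (contDiffOn_coord k)

lemma dzbDer_coord (l k : Fin n) : dzbDer l (coord B k) = 0 := smoothAlg_ext fun z => by
  have : ∀ v, fderiv ℝ (fun z : Fin n → ℂ => z k) z v = v k := fun v => by
    exact congrArg (· v) (ContinuousLinearMap.proj (R := ℝ) (φ := fun _ : Fin n => ℂ) k).fderiv
  rw [coord, dzbDer_smk, evalAt_smk, dzb, this, this, map_zero]
  by_cases h : k = l
  · subst h; simp
  · simp [h]

end SmoothAlgebra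

section Inverse

variable {n : ℕ} {V : Type*} [NormedAddCommGroup V] [NormedSpace ℝ V]

lemma contDiffOn_det {s : Set V} {A : V → Matrix (Fin n) (Fin n) ℂ}
    (hA : ∀ i j, ContDiffOn ℝ ∞ (fun z => A z i j) s) :
    ContDiffOn ℝ ∞ (fun z => (A z).det) s := by
  simp only [Matrix.det_apply']
  exact ContDiffOn.sum fun σ _ => contDiffOn_const.mul (contDiffOn_prod fun i _ => hA _ _)

lemma contDiffOn_matrix_inv {s : Set V} {A : V → Matrix (Fin n) (Fin n) ℂ}
    (hA : ∀ i j, ContDiffOn ℝ ∞ (fun z => A z i j) s) (hdet : ∀ z ∈ s, (A z).det ≠ 0)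
    (i j : Fin n) : ContDiffOn ℝ ∞ (fun z => (A z)⁻¹ i j) s := by
  simp only [Matrix.inv_def, Matrix.smul_apply, Ring.inverse_eq_inv', smul_eq_mul,
    Matrix.adjugate_apply]
  refine ((contDiffOn_det hA).inv hdet).mul (contDiffOn_det fun a b => ?_)
  by_cases h : a = j
  · subst h; simpa using contDiffOn_const
  · simpa [h] using hA a b

end Inverse

/-! ### Expansion of smooth functions in z^k and ∂_kΦ -/

section Expansion

variable {n : ℕ} {B : Opens (Fin n → ℂ)}

/-- Hadamard's lemma expands f in the increments of z and z̄. Applied to u_k = ∂_kΦ, it gives a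
linear system for the increments of z̄ whose matrix is the segment average of g; inverting it
exchanges z̄ for u. -/
lemma hasExpansion (K : KahlerAlgebra (Fin n) (smoothAlg B)) (hDb : K.Db = dzbDer)
    (hc : Convex ℝ (B : Set (Fin n → ℂ))) (y : B)
    (hdet : ∀ z : B, (Matrix.of fun k l =>
      ∫ t in (0 : ℝ)..1, sext (K.g k l) (y + t • ((z : Fin n → ℂ) - y))).det ≠ 0) :
    K.HasExpansion (coord B) (evalAt y) := by
  intro f
  set u : Fin n → (Fin n → ℂ) → ℂ := fun k => sext (K.D k K.pot) with hu
  have hus : ∀ k, ContDiffOn ℝ ∞ (u k) B := fun k => contDiffOn_sext _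
  have hdzb : ∀ k l, Set.EqOn (dzb l (u k)) (sext (K.g k l)) B := fun k l z hz => by
    rw [← K.Db_D_pot, hDb]
    conv_rhs => rw [← smk_sext (K.D k K.pot), dzbDer_smk]
    exact (sext_smk _ _ hz).symm
  set P : Fin n → Fin n → (Fin n → ℂ) → ℂ := fun k l z =>
    ∫ t in (0 : ℝ)..1, dz l (u k) ((y : Fin n → ℂ) + t • (z - y)) with hP
  set Q : Fin n → Fin n → (Fin n → ℂ) → ℂ := fun k l z =>
    ∫ t in (0 : ℝ)..1, dzb l (u k) ((y : Fin n → ℂ) + t • (z - y)) with hQ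
  have hPs : ∀ k l, ContDiffOn ℝ ∞ (P k l) B := fun k l =>
    contDiffOn_average B.isOpen hc y.2 (contDiffOn_dz B.isOpen (hus k) l)
  have hQs : ∀ k l, ContDiffOn ℝ ∞ (Q k l) B := fun k l =>
    contDiffOn_average B.isOpen hc y.2 (contDiffOn_dzb B.isOpen (hus k) l)
  have hQg : ∀ k l, ∀ z ∈ B, Q k l z =
      ∫ t in (0 : ℝ)..1, sext (K.g k l) ((y : Fin n → ℂ) + t • (z - y)) := fun k l z hz => by
    refine intervalIntegral.integral_congr fun t ht => ?_
    rw [Set.uIcc_of_le zero_le_one] at ht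
    exact hdzb k l (segment_point_mem hc y.2 hz ht)
  set A : (Fin n → ℂ) → Matrix (Fin n) (Fin n) ℂ := fun z => Matrix.of fun k l => Q k l z with hA
  have hAdet : ∀ z ∈ (B : Set (Fin n → ℂ)), (A z).det ≠ 0 := fun z hz => by
    have := hdet ⟨z, hz⟩
    simp only [← hQg _ _ z hz] at this
    exact this
  have hAi : ∀ i j, ContDiffOn ℝ ∞ (fun z => (A z)⁻¹ i j) B :=
    contDiffOn_matrix_inv (fun i j => hQs i j) hAdet
  set a₀ : Fin n → (Fin n → ℂ) → ℂ := fun k z =>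
    ∫ t in (0 : ℝ)..1, dz k (sext f) ((y : Fin n → ℂ) + t • (z - y)) with ha₀
  set b₀ : Fin n → (Fin n → ℂ) → ℂ := fun k z =>
    ∫ t in (0 : ℝ)..1, dzb k (sext f) ((y : Fin n → ℂ) + t • (z - y)) with hb₀
  have ha₀s : ∀ k, ContDiffOn ℝ ∞ (a₀ k) B := fun k =>
    contDiffOn_average B.isOpen hc y.2 (contDiffOn_dz B.isOpen (contDiffOn_sext f) k)
  have hb₀s : ∀ k, ContDiffOn ℝ ∞ (b₀ k) B := fun k =>
    contDiffOn_average B.isOpen hc y.2 (contDiffOn_dzb B.isOpen (contDiffOn_sext f) k)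
  -- With w = z - y, the system is u - u(y) - P w = A w̄. Substituting w̄ = A⁻¹(u - u(y) - P w) in
  -- b₀ · w̄ leaves b₀A⁻¹ as coefficient of u - u(y) and corrects a₀ by -bP.
  set b : Fin n → (Fin n → ℂ) → ℂ := fun k z => ∑ j, b₀ j z * (A z)⁻¹ j k with hb
  have hbs : ∀ k, ContDiffOn ℝ ∞ (b k) B := fun k =>
    ContDiffOn.sum fun j _ => (hb₀s j).mul (hAi j k)
  have has : ∀ i, ContDiffOn ℝ ∞ (fun z => a₀ i z - ∑ k, b k z * P k i z) B := fun i =>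
    (ha₀s i).sub (ContDiffOn.sum fun k _ => (hbs k).mul (hPs k i))
  refine ⟨fun i => smk _ (has i), fun k => smk _ (hbs k), smoothAlg_ext fun z => ?_⟩
  have e1 := hadamard B.isOpen hc y.2 z.2 (contDiffOn_sext f)
  have e2 : ∀ k, u k z - u k y - ∑ i, ((z : Fin n → ℂ) i - (y : Fin n → ℂ) i) * P k i z
      = ∑ j, Q k j z * starRingEnd ℂ ((z : Fin n → ℂ) j - (y : Fin n → ℂ) j) := fun k => by
    have := hadamard B.isOpen hc y.2 z.2 (hus k)
    rw [this]; simp only [hP, hQ, mul_comm (starRingEnd ℂ _)]; ring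
  have e3 : ∑ j, starRingEnd ℂ ((z : Fin n → ℂ) j - (y : Fin n → ℂ) j) * b₀ j z
      = ∑ k, (u k z - u k y - ∑ i, ((z : Fin n → ℂ) i - (y : Fin n → ℂ) i) * P k i z) * b k z := by
    have hinv : (A z)⁻¹ * A z = 1 := Matrix.nonsing_inv_mul _ (isUnit_iff_ne_zero.mpr (hAdet z z.2))
    simp only [e2]
    set c : Fin n → ℂ := fun j => starRingEnd ℂ ((z : Fin n → ℂ) j - (y : Fin n → ℂ) j) with hcdef
    have e4 : (A z)⁻¹.mulVec ((A z).mulVec c) = c := by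
      rw [Matrix.mulVec_mulVec, hinv, Matrix.one_mulVec]
    calc ∑ j, c j * b₀ j z = ∑ j, ((A z)⁻¹.mulVec ((A z).mulVec c)) j * b₀ j z := by rw [e4]
      _ = ∑ j, ∑ k, (∑ j, Q k j z * c j) * (b₀ j z * (A z)⁻¹ j k) := by
        refine Finset.sum_congr rfl fun j _ => ?_
        rw [Matrix.mulVec, dotProduct, Finset.sum_mul]
        refine Finset.sum_congr rfl fun k _ => ?_
        rw [Matrix.mulVec, dotProduct]
        simp only [hA, Matrix.of_apply]; ring
      _ = _ := by rw [Finset.sum_comm]; simp only [hb, hcdef, Finset.mul_sum]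
  rw [evalAt_apply, ← sext_apply, e1, e3]
  simp only [map_add, map_sum, map_mul, map_sub, AlgHom.commutes, evalAt_smk, coord,
    Algebra.algebraMap_self, RingHom.id_apply]
  have e5 : ∀ k (w : B), evalAt w (K.D k K.pot) = u k w := fun k w => (sext_apply _ w).symm
  simp only [e5, evalAt_apply y f, ← sext_apply, mul_sub, sub_mul, Finset.sum_sub_distrib,
    Finset.mul_sum, Finset.sum_mul]
  rw [Finset.sum_comm (f := fun i k => (y : Fin n → ℂ) i * (b k z * P k i z)),
    Finset.sum_comm (f := fun i k => (z : Fin n → ℂ) i * (b k z * P k i z))]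
  simp only [mul_comm (b _ _) (P _ _ _), mul_assoc]
  ring

/-- Invertibility is an open condition, and on a small ball all segment averages stay close to the
matrix at the centre. -/
lemma exists_ball_det_average_ne_zero {O : Set (Fin n → ℂ)} (hO : IsOpen O) {x : Fin n → ℂ}
    (hx : x ∈ O) {G : Fin n → Fin n → (Fin n → ℂ) → ℂ} (hG : ∀ k l, ContinuousOn (G k l) O)
    (hdet : (Matrix.of fun k l => G k l x).det ≠ 0) :
    ∃ r > 0, Metric.ball x r ⊆ O ∧ ∀ y ∈ Metric.ball x r, ∀ z ∈ Metric.ball x r,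
      (Matrix.of fun k l => ∫ t in (0 : ℝ)..1, G k l (y + t • (z - y))).det ≠ 0 := by
  have hcont : Continuous fun A : Fin n → Fin n → ℂ => (Matrix.of A).det := by
    exact Continuous.matrix_det continuous_id
  have hopen : IsOpen {A : Fin n → Fin n → ℂ | (Matrix.of A).det ≠ 0} :=
    isOpen_ne.preimage hcont
  -- A closed ball, since the integral estimate below is not strict.
  obtain ⟨ε, hε, hεs⟩ := Metric.nhds_basis_closedBall.mem_iff.mp
    (hopen.mem_nhds (x := fun k l => G k l x) hdet)
  have hev : ∀ᶠ z in 𝓝 x, z ∈ O ∧ ∀ k l, dist (G k l z) (G k l x) < ε := by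
    refine Filter.Eventually.and (hO.mem_nhds hx) ?_
    rw [Filter.eventually_all]; intro k
    rw [Filter.eventually_all]; intro l
    exact ((hG k l).continuousAt (hO.mem_nhds hx)) (Metric.ball_mem_nhds _ hε)
  obtain ⟨r, hr, hrs⟩ := Metric.nhds_basis_ball.mem_iff.mp hev
  refine ⟨r, hr, fun z hz => (hrs hz).1, fun y hy z hz => ?_⟩
  refine hεs (Metric.mem_closedBall.mpr ?_)
  rw [dist_pi_le_iff hε.le]; intro k
  rw [dist_pi_le_iff hε.le]; intro l
  have hseg : ∀ t ∈ Set.uIoc (0 : ℝ) 1, y + t • (z - y) ∈ Metric.ball x r := fun t ht => by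
    rw [Set.uIoc_of_le zero_le_one] at ht
    exact segment_point_mem (convex_ball x r) hy hz ⟨ht.1.le, ht.2⟩
  have hInt : IntervalIntegrable (fun t : ℝ => G k l (y + t • (z - y)))
      MeasureTheory.volume 0 1 :=
    (continuousOn_comp_segment (convex_ball x r)
      ((hG k l).mono fun w hw => (hrs hw).1) hy hz).intervalIntegrable
  have e : (∫ t in (0 : ℝ)..1, G k l (y + t • (z - y))) - G k l x
      = ∫ t in (0 : ℝ)..1, (G k l (y + t • (z - y)) - G k l x) := by
    rw [intervalIntegral.integral_sub hInt intervalIntegrable_const]; simp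
  rw [dist_eq_norm, e]
  have := intervalIntegral.norm_integral_le_of_norm_le_const (a := (0 : ℝ)) (b := 1) (C := ε)
    (f := fun t : ℝ => G k l (y + t • (z - y)) - G k l x) fun t ht => by
      rw [← dist_eq_norm]; exact ((hrs (hseg t ht)).2 k l).le
  simpa using this

end Expansion

end KahlerStar

end

/-! ### Nondegeneracy of the metric, functions in charts, locality of bidifferential operators -/

noncomputable section

namespace KahlerStar

open TopologicalSpace (Opens)

section Nondegenerate

variable {n : ℕ}

/-- The matrix `i F(∂_k, ∂̄_l)` of a nondegenerate real form of type (1,1) on `ℂⁿ` is invertible. -/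
lemma det_ne_zero_of_nondegenerate (P : LinearMap.BilinForm ℝ (Fin n → ℂ))
    (hI : ∀ v w, P (Complex.I • v) (Complex.I • w) = P v w)
    (hnd : ∀ v, (∀ w, P v w = 0) → v = 0) :
    (Matrix.of fun k l : Fin n => Complex.I * (1 / 4) *
      ((P (Pi.single k 1) (Pi.single l 1) : ℂ)
        + (P (Pi.single k Complex.I) (Pi.single l Complex.I) : ℂ)
        + Complex.I * ((P (Pi.single k 1) (Pi.single l Complex.I) : ℂ)
          - (P (Pi.single k Complex.I) (Pi.single l 1) : ℂ)))).det ≠ 0 := by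
  have hI2 : ∀ v : Fin n → ℂ, Complex.I • Complex.I • v = -v := fun v => by
    rw [smul_smul, Complex.I_mul_I, neg_one_smul]
  have hneg : ∀ v w, P (Complex.I • v) w = -P v (Complex.I • w) := fun v w => by
    rw [← hI (Complex.I • v) w, hI2]; simp
  have hsingle : ∀ k : Fin n,
      (Pi.single k Complex.I : Fin n → ℂ) = Complex.I • Pi.single k 1 := fun k => by
    rw [← Pi.single_smul]; simp
  -- H is the sesquilinear form with real part P; the matrix in question is i/2 times its Gram
  -- matrix in the standard basis.
  let H : (Fin n → ℂ) → (Fin n → ℂ) → ℂ := fun v w => P v w + Complex.I * P v (Complex.I • w)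
  have H_add_left : ∀ v v' w, H (v + v') w = H v w + H v' w := fun v v' w => by
    simp only [H, map_add, LinearMap.add_apply]; push_cast; ring
  have H_add_right : ∀ v w w', H v (w + w') = H v w + H v w' := fun v w w' => by
    simp only [H, smul_add, map_add]; push_cast; ring
  have H_real_left : ∀ (r : ℝ) v w, H (r • v) w = r * H v w := fun r v w => by
    simp only [H, map_smul, LinearMap.smul_apply, smul_eq_mul]; push_cast; ring
  have H_real_right : ∀ (r : ℝ) v w, H v (r • w) = r * H v w := fun r v w => by
    simp only [H, smul_comm Complex.I r w, map_smul, smul_eq_mul]; push_cast; ring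
  have H_I_left : ∀ v w, H (Complex.I • v) w = Complex.I * H v w := fun v w => by
    simp only [H, hneg, hI2, map_neg]; push_cast
    linear_combination (-(P v (Complex.I • w)) : ℂ) * Complex.I_sq
  have H_I_right : ∀ v w, H v (Complex.I • w) = -Complex.I * H v w := fun v w => by
    simp only [H, hI2, map_neg]; push_cast
    linear_combination ((P v (Complex.I • w)) : ℂ) * Complex.I_sq
  have hdec : ∀ (c : ℂ) (v : Fin n → ℂ), c • v = c.re • v + c.im • Complex.I • v := fun c v => by
    ext i
    simp only [Pi.smul_apply, Pi.add_apply, smul_eq_mul, Complex.real_smul]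
    conv_lhs => rw [← Complex.re_add_im c]
    ring
  have H_smul_left : ∀ (c : ℂ) v w, H (c • v) w = c * H v w := fun c v w => by
    rw [hdec, H_add_left, H_real_left, H_real_left, H_I_left]
    conv_rhs => rw [← Complex.re_add_im c]
    ring
  have H_smul_right : ∀ (c : ℂ) v w, H v (c • w) = starRingEnd ℂ c * H v w := fun c v w => by
    rw [hdec, H_add_right, H_real_right, H_real_right, H_I_right]
    have : starRingEnd ℂ c = c.re - c.im * Complex.I := by apply Complex.ext <;> simp
    rw [this]; ring
  let HL : (Fin n → ℂ) → ((Fin n → ℂ) →+ ℂ) := fun w => AddMonoidHom.mk' (H · w) (H_add_left · · w)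
  let HR : (Fin n → ℂ) → ((Fin n → ℂ) →+ ℂ) := fun v => AddMonoidHom.mk' (H v) (H_add_right v)
  have hdecomp : ∀ v : Fin n → ℂ, v = ∑ k, v k • (Pi.single k 1 : Fin n → ℂ) := fun v => by
    conv_lhs => rw [← Finset.univ_sum_single v]
    refine Finset.sum_congr rfl fun k _ => ?_
    rw [← Pi.single_smul]; simp
  have H_left : ∀ v w, H v w = ∑ k, v k * H (Pi.single k 1) w := fun v w => by
    have := congrArg (HL w) (hdecomp v)
    rw [map_sum] at this
    refine this.trans (Finset.sum_congr rfl fun k _ => H_smul_left _ _ _)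
  have H_right : ∀ v w, H v w = ∑ k, starRingEnd ℂ (w k) * H v (Pi.single k 1) := fun v w => by
    have := congrArg (HR v) (hdecomp w)
    rw [map_sum] at this
    refine this.trans (Finset.sum_congr rfl fun k _ => H_smul_right _ _ _)
  intro hdet
  -- A left null vector c of the matrix satisfies H(c, ·) = 0, hence P(c, ·) = 0, against
  -- nondegeneracy.
  obtain ⟨c, hc0, hc⟩ := Matrix.exists_vecMul_eq_zero_iff.mpr hdet
  refine hc0 (hnd c fun w => ?_)
  have h1 : ∀ l, H c (Pi.single l 1) = 0 := fun l => by
    have := congrFun hc l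
    simp only [Matrix.vecMul, dotProduct, Matrix.of_apply, Pi.zero_apply] at this
    rw [H_left]
    have e : ∀ k, Complex.I * (1 / 4) * ((P (Pi.single k 1) (Pi.single l 1) : ℂ)
        + (P (Pi.single k Complex.I) (Pi.single l Complex.I) : ℂ)
        + Complex.I * ((P (Pi.single k 1) (Pi.single l Complex.I) : ℂ)
          - (P (Pi.single k Complex.I) (Pi.single l 1) : ℂ)))
        = Complex.I / 2 * H (Pi.single k 1) (Pi.single l 1) := fun k => by
      simp only [hsingle, hI, hneg, H]; push_cast; ring
    simp only [e, mul_left_comm _ (Complex.I / 2), ← Finset.mul_sum] at this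
    exact (mul_eq_zero.mp this).resolve_left (by simp)
  have h2 : H c w = 0 := by rw [H_right]; simp [h1]
  have := congrArg Complex.re h2
  simpa [H] using this

variable {M : Type*} [TopologicalSpace M] [ChartedSpace (Fin n → ℂ) M]

/-- The derivative of `e.symm` is a complex-linear bijection, so the pullback to ℂⁿ is again
nondegenerate of type (1,1). -/
lemma det_g_ne_zero (Ω : PseudoKahlerForm n M) {e : OpenPartialHomeomorph M (Fin n → ℂ)}
    (he : IsHolChart e) {x : M} (hx : x ∈ e.source) :
    (Matrix.of fun k l => Ω.g e k l x).det ≠ 0 := by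
  have he1 : e ∈ IsManifold.maximalAtlas 𝓘(ℂ, Fin n → ℂ) 1 M :=
    IsManifold.maximalAtlas_subset_of_le le_top he
  have hmd : e.MDifferentiable 𝓘(ℂ, Fin n → ℂ) 𝓘(ℂ, Fin n → ℂ) :=
    ⟨fun y hy => (mdifferentiableAt_of_mem_maximalAtlas he1 hy).mdifferentiableWithinAt,
      fun y hy => (mdifferentiableAt_symm_of_mem_maximalAtlas he1 hy).mdifferentiableWithinAt⟩
  have hx' : e x ∈ e.symm.source := e.map_source hx
  have hinj := hmd.symm.mfderiv_injective hx'
  have hsurj := hmd.symm.mfderiv_surjective hx'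
  set L := mfderiv 𝓘(ℂ, Fin n → ℂ) 𝓘(ℂ, Fin n → ℂ) e.symm (e x) with hL
  have hLr : ∀ (r : ℝ) (v : Fin n → ℂ), L (r • v : Fin n → ℂ) = r • L v := fun r v => by
    have : (r • v : Fin n → ℂ) = (r : ℂ) • v := by ext i; simp
    rw [this]; exact L.map_smul (r : ℂ) v
  let P : LinearMap.BilinForm ℝ (Fin n → ℂ) := LinearMap.mk₂ ℝ (pullForm Ω.form e (e x))
    (fun v v' w => by
      simp only [pullForm, ← hL]
      rw [show L (v + v' : Fin n → ℂ) = L v + L v' from L.map_add v v', map_add,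
        LinearMap.add_apply])
    (fun r v w => by
      simp only [pullForm, ← hL]; rw [hLr, map_smul, LinearMap.smul_apply])
    (fun v w w' => by
      simp only [pullForm, ← hL]
      rw [show L (w + w' : Fin n → ℂ) = L w + L w' from L.map_add w w', map_add])
    (fun r v w => by
      simp only [pullForm, ← hL]; rw [hLr, map_smul])
  have hP : ∀ v w, P v w = Ω.form (e.symm (e x)) (L v) (L w) := fun _ _ => rfl
  refine det_ne_zero_of_nondegenerate P (fun v w => ?_) fun v hv => ?_
  · rw [hP, hP, show L (Complex.I • v : Fin n → ℂ) = Complex.I • L v from L.map_smul _ v,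
      show L (Complex.I • w : Fin n → ℂ) = Complex.I • L w from L.map_smul _ w, Ω.type_one_one]
  · have : L v = 0 := Ω.nondegenerate _ _ fun w => by
      obtain ⟨w', rfl⟩ := hsurj w
      exact hv w'
    exact hinj (this.trans (map_zero L).symm)

end Nondegenerate

section Coordinates

variable {n : ℕ} {M : Type*} [TopologicalSpace M] {e : OpenPartialHomeomorph M (Fin n → ℂ)}

lemma del_apply_symm (k : Fin n) (f : M → ℂ) {z : Fin n → ℂ} (hz : z ∈ e.target) :
    del e k f (e.symm z) = dz k (f ∘ e.symm) z := by
  simp only [del, dz, e.right_inv hz]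

lemma delBar_apply_symm (k : Fin n) (f : M → ℂ) {z : Fin n → ℂ} (hz : z ∈ e.target) :
    delBar e k f (e.symm z) = dzb k (f ∘ e.symm) z := by
  simp only [delBar, dzb, e.right_inv hz]

lemma image_subset_target {W : Set M} (hWe : W ⊆ e.source) : e '' W ⊆ e.target := by
  rintro _ ⟨x, hx, rfl⟩; exact e.map_source (hWe hx)

lemma comp_symm_eventuallyEq {f f' : M → ℂ} {W : Set M} (hW : IsOpen W)
    (hWe : W ⊆ e.source) (h : Set.EqOn f f' W) {x : M} (hx : x ∈ W) :
    f ∘ e.symm =ᶠ[𝓝 (e x)] f' ∘ e.symm := by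
  refine Filter.eventuallyEq_of_mem ((e.isOpen_image_of_subset_source hW hWe).mem_nhds
    (Set.mem_image_of_mem e hx)) ?_
  rintro _ ⟨y, hy, rfl⟩
  simp only [Function.comp, e.left_inv (hWe hy), h hy]

lemma iterDel_congr {f f' : M → ℂ} {W : Set M} (hW : IsOpen W)
    (hWe : W ⊆ e.source) (h : Set.EqOn f f' W) (w : List (Fin n ⊕ Fin n)) :
    Set.EqOn (iterDel e w f) (iterDel e w f') W := by
  induction w with
  | nil => exact h
  | cons a w ih => cases a with
    | inl k => intro x hx; simp only [iterDel, del, (comp_symm_eventuallyEq hW hWe ih hx).fderiv_eq]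
    | inr l =>
      intro x hx; simp only [iterDel, delBar, (comp_symm_eventuallyEq hW hWe ih hx).fderiv_eq]

end Coordinates

section Charts

variable {n : ℕ} {M : Type*} [TopologicalSpace M] [ChartedSpace (Fin n → ℂ) M]
  {e : OpenPartialHomeomorph M (Fin n → ℂ)}

lemma IsHolChart.mem_real_maximalAtlas (he : IsHolChart e) :
    e ∈ IsManifold.maximalAtlas 𝓘(ℝ, Fin n → ℂ) ∞ M := by
  refine StructureGroupoid.maximalAtlas_mono ?_ he
  refine groupoid_of_pregroupoid_le _ _ fun f s hfs => ?_
  exact (ContDiffOn.restrict_scalars ℝ hfs).of_le le_top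

lemma smoothOn_iff (he : IsHolChart e) {f : M → ℂ} {W : Set M} (hW : W ⊆ e.source) :
    SmoothOn n f W ↔ ContDiffOn ℝ ∞ (f ∘ e.symm) (e '' W) := by
  have := contMDiffOn_iff_of_mem_maximalAtlas' (f := f) he.mem_real_maximalAtlas
    (IsManifold.chart_mem_maximalAtlas (I := 𝓘(ℝ, ℂ)) (n := ∞) (0 : ℂ)) hW
    (fun _ _ => Set.mem_univ _)
  refine this.trans ?_
  simp [OpenPartialHomeomorph.extend, chartAt_self_eq, Function.comp_def]

lemma SmoothOn.del (he : IsHolChart e) {f : M → ℂ} {W : Set M} (hW : IsOpen W)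
    (hWe : W ⊆ e.source) (hf : SmoothOn n f W) (k : Fin n) : SmoothOn n (del e k f) W := by
  rw [smoothOn_iff he hWe] at hf ⊢
  exact (contDiffOn_dz (e.isOpen_image_of_subset_source hW hWe) hf k).congr
    fun z hz => del_apply_symm k f (image_subset_target hWe hz)

lemma SmoothOn.delBar (he : IsHolChart e) {f : M → ℂ} {W : Set M} (hW : IsOpen W)
    (hWe : W ⊆ e.source) (hf : SmoothOn n f W) (k : Fin n) : SmoothOn n (delBar e k f) W := by
  rw [smoothOn_iff he hWe] at hf ⊢
  exact (contDiffOn_dzb (e.isOpen_image_of_subset_source hW hWe) hf k).congr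
    fun z hz => delBar_apply_symm k f (image_subset_target hWe hz)

lemma SmoothOn.iterDel (he : IsHolChart e) {f : M → ℂ} {W : Set M} (hW : IsOpen W)
    (hWe : W ⊆ e.source) (hf : SmoothOn n f W) (w : List (Fin n ⊕ Fin n)) :
    SmoothOn n (iterDel e w f) W := by
  induction w with
  | nil => exact hf
  | cons a w ih => cases a with
    | inl k => exact ih.del he hW hWe k
    | inr l => exact ih.delBar he hW hWe l

lemma SmoothOn.differentiableAt (he : IsHolChart e) {f : M → ℂ} {W : Set M} (hW : IsOpen W)
    (hWe : W ⊆ e.source) (hf : SmoothOn n f W) {x : M} (hx : x ∈ W) :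
    DifferentiableAt ℝ (f ∘ e.symm) (e x) :=
  (((smoothOn_iff he hWe).mp hf).differentiableOn (by simp)).differentiableAt
    ((e.isOpen_image_of_subset_source hW hWe).mem_nhds (Set.mem_image_of_mem e hx))

lemma iterDel_add (he : IsHolChart e) {f f' : M → ℂ} {W : Set M} (hW : IsOpen W)
    (hWe : W ⊆ e.source) (hf : SmoothOn n f W) (hf' : SmoothOn n f' W)
    (w : List (Fin n ⊕ Fin n)) :
    Set.EqOn (iterDel e w (f + f')) (iterDel e w f + iterDel e w f') W := by
  induction w with
  | nil => exact fun _ _ => rfl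
  | cons a w ih =>
    have key : ∀ x ∈ W, fderiv ℝ (iterDel e w (f + f') ∘ e.symm) (e x)
        = fderiv ℝ (iterDel e w f ∘ e.symm) (e x) + fderiv ℝ (iterDel e w f' ∘ e.symm) (e x) :=
      fun x hx => by
      rw [(comp_symm_eventuallyEq hW hWe ih hx).fderiv_eq]
      exact fderiv_add ((hf.iterDel he hW hWe w).differentiableAt he hW hWe hx)
        ((hf'.iterDel he hW hWe w).differentiableAt he hW hWe hx)
    cases a with
    | inl k =>
      intro x hx
      simp only [iterDel, del, key x hx, Pi.add_apply, add_apply]; ring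
    | inr l =>
      intro x hx
      simp only [iterDel, delBar, key x hx, Pi.add_apply, add_apply]; ring

lemma SmoothOn.mono {f : M → ℂ} {W W' : Set M} (hf : SmoothOn n f W) (h : W' ⊆ W) :
    SmoothOn n f W' := ContMDiffOn.mono hf h

lemma SmoothOn.congr {f f' : M → ℂ} {W : Set M} (hf : SmoothOn n f W) (h : Set.EqOn f' f W) :
    SmoothOn n f' W := ContMDiffOn.congr hf h

end Charts

section Bidifferential

variable {n : ℕ} {M : Type*} [TopologicalSpace M] [ChartedSpace (Fin n → ℂ) M]
  {e : OpenPartialHomeomorph M (Fin n → ℂ)} {B : (M → ℂ) → (M → ℂ) → (M → ℂ)}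
  (hB : IsBidifferential (n := n) B) (he : IsHolChart e) {W : Set M} (hW : IsOpen W)
  (hWe : W ⊆ e.source)
include hB he hW hWe

/-- Locality, which makes the coefficients well defined on functions known only over a coordinate
ball. -/
lemma IsBidifferential.congr {f f' h h' : M → ℂ} (hf : SmoothOn n f W) (hh : SmoothOn n h W)
    (hff' : Set.EqOn f f' W) (hhh' : Set.EqOn h h' W) : Set.EqOn (B f h) (B f' h') W := by
  intro x hx
  obtain ⟨V, hV, hxV, hVe, S, c, hc, hS⟩ := hB e he x (hWe hx)
  have hWV := hW.inter hV
  have hf1 := hf.mono (Set.inter_subset_left (t := V))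
  have hh1 := hh.mono (Set.inter_subset_left (t := V))
  have ef := hff'.mono (Set.inter_subset_left (t := V))
  have eh := hhh'.mono (Set.inter_subset_left (t := V))
  have hsub : W ∩ V ⊆ e.source := fun y hy => hVe hy.2
  rw [hS (W ∩ V) f h hWV Set.inter_subset_right hf1 hh1 x ⟨hx, hxV⟩,
    hS (W ∩ V) f' h' hWV Set.inter_subset_right (hf1.congr ef.symm) (hh1.congr eh.symm) x ⟨hx, hxV⟩]
  refine Finset.sum_congr rfl fun p _ => ?_
  rw [iterDel_congr hWV hsub ef p.1 ⟨hx, hxV⟩, iterDel_congr hWV hsub eh p.2 ⟨hx, hxV⟩]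

lemma IsBidifferential.add_left {f f' h : M → ℂ} (hf : SmoothOn n f W) (hf' : SmoothOn n f' W)
    (hh : SmoothOn n h W) : Set.EqOn (B (f + f') h) (B f h + B f' h) W := by
  intro x hx
  obtain ⟨V, hV, hxV, hVe, S, c, hc, hS⟩ := hB e he x (hWe hx)
  have hWV := hW.inter hV
  have hf1 := hf.mono (Set.inter_subset_left (t := V))
  have hf1' := hf'.mono (Set.inter_subset_left (t := V))
  have hh1 := hh.mono (Set.inter_subset_left (t := V))
  have hsub : W ∩ V ⊆ e.source := fun y hy => hVe hy.2
  rw [Pi.add_apply, hS (W ∩ V) f h hWV Set.inter_subset_right hf1 hh1 x ⟨hx, hxV⟩,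
    hS (W ∩ V) f' h hWV Set.inter_subset_right hf1' hh1 x ⟨hx, hxV⟩,
    hS (W ∩ V) (f + f') h hWV Set.inter_subset_right (ContMDiffOn.add hf1 hf1') hh1 x ⟨hx, hxV⟩,
    ← Finset.sum_add_distrib]
  refine Finset.sum_congr rfl fun p _ => ?_
  rw [iterDel_add he hWV hsub hf1 hf1' p.1 ⟨hx, hxV⟩, Pi.add_apply]; ring

lemma IsBidifferential.add_right {f h h' : M → ℂ} (hf : SmoothOn n f W) (hh : SmoothOn n h W)
    (hh' : SmoothOn n h' W) : Set.EqOn (B f (h + h')) (B f h + B f h') W := by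
  intro x hx
  obtain ⟨V, hV, hxV, hVe, S, c, hc, hS⟩ := hB e he x (hWe hx)
  have hWV := hW.inter hV
  have hf1 := hf.mono (Set.inter_subset_left (t := V))
  have hh1 := hh.mono (Set.inter_subset_left (t := V))
  have hh1' := hh'.mono (Set.inter_subset_left (t := V))
  have hsub : W ∩ V ⊆ e.source := fun y hy => hVe hy.2
  rw [Pi.add_apply, hS (W ∩ V) f h hWV Set.inter_subset_right hf1 hh1 x ⟨hx, hxV⟩,
    hS (W ∩ V) f h' hWV Set.inter_subset_right hf1 hh1' x ⟨hx, hxV⟩,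
    hS (W ∩ V) f (h + h') hWV Set.inter_subset_right hf1 (ContMDiffOn.add hh1 hh1') x ⟨hx, hxV⟩,
    ← Finset.sum_add_distrib]
  refine Finset.sum_congr rfl fun p _ => ?_
  rw [iterDel_add he hWV hsub hh1 hh1' p.2 ⟨hx, hxV⟩, Pi.add_apply]; ring

lemma IsBidifferential.smoothOn {f h : M → ℂ} (hf : SmoothOn n f W) (hh : SmoothOn n h W) :
    SmoothOn n (B f h) W := by
  refine contMDiffOn_of_locally_contMDiffOn fun x hx => ?_
  obtain ⟨V, hV, hxV, hVe, S, c, hc, hS⟩ := hB e he x (hWe hx)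
  have hWV := hW.inter hV
  have hf1 := hf.mono (Set.inter_subset_left (t := V))
  have hh1 := hh.mono (Set.inter_subset_left (t := V))
  have hsub : W ∩ V ⊆ e.source := fun y hy => hVe hy.2
  refine ⟨V, hV, hxV, ?_⟩
  refine (smoothOn_iff he hsub).mpr ?_
  have hterm : ContDiffOn ℝ ∞ (fun z => ∑ p ∈ S, c p (e.symm z) * iterDel e p.1 f (e.symm z)
      * iterDel e p.2 h (e.symm z)) (e '' (W ∩ V)) :=
    ContDiffOn.sum fun p hp =>
      (((smoothOn_iff he hsub).mp ((hc p hp).mono Set.inter_subset_right)).mul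
        ((smoothOn_iff he hsub).mp (hf1.iterDel he hWV hsub p.1))).mul
        ((smoothOn_iff he hsub).mp (hh1.iterDel he hWV hsub p.2))
  refine hterm.congr ?_
  rintro _ ⟨y, hy, rfl⟩
  simpa only [Function.comp, e.left_inv (hsub hy)] using
    hS (W ∩ V) f h hWV Set.inter_subset_right hf1 hh1 y hy

end Bidifferential

end KahlerStar

end

/-! ### Coordinate expressions of functions and of the Kähler geometry -/

noncomputable section

namespace KahlerStar

open TopologicalSpace (Opens)

section Represents

variable {n : ℕ} {M : Type*} [TopologicalSpace M]
  {e : OpenPartialHomeomorph M (Fin n → ℂ)} {B : Opens (Fin n → ℂ)}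

/-- `F ∈ C^∞(B)` is the coordinate expression of the function `f` over `B ⊆ e.target`. -/
def Rep (e : OpenPartialHomeomorph M (Fin n → ℂ)) (f : M → ℂ) (F : smoothAlg B) : Prop :=
  ∀ z : B, f (e.symm z) = evalAt z F

namespace Rep

lemma const (c : ℂ) : Rep e (fun _ => c) (algebraMap ℂ (smoothAlg B) c) := fun _ => rfl

lemma zero : Rep e 0 (0 : smoothAlg B) := fun _ => rfl

lemma one : Rep e 1 (1 : smoothAlg B) := fun _ => rfl

lemma add {f h : M → ℂ} {F H : smoothAlg B} (hf : Rep e f F) (hh : Rep e h H) :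
    Rep e (fun x => f x + h x) (F + H) := fun z => by rw [map_add, ← hf, ← hh]

lemma sub {f h : M → ℂ} {F H : smoothAlg B} (hf : Rep e f F) (hh : Rep e h H) :
    Rep e (fun x => f x - h x) (F - H) := fun z => by rw [map_sub, ← hf, ← hh]

lemma mul {f h : M → ℂ} {F H : smoothAlg B} (hf : Rep e f F) (hh : Rep e h H) :
    Rep e (fun x => f x * h x) (F * H) := fun z => by rw [map_mul, ← hf, ← hh]

lemma neg {f : M → ℂ} {F : smoothAlg B} (hf : Rep e f F) :
    Rep e (fun x => -f x) (-F) := fun z => by rw [map_neg, ← hf]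

lemma const_mul (c : ℂ) {f : M → ℂ} {F : smoothAlg B} (hf : Rep e f F) :
    Rep e (fun x => c * f x) (c • F) := fun z => by rw [map_smul, ← hf, smul_eq_mul]

lemma sum {ι : Type*} (s : Finset ι) {f : ι → M → ℂ} {F : ι → smoothAlg B}
    (h : ∀ i, Rep e (f i) (F i)) : Rep e (fun x => ∑ i ∈ s, f i x) (∑ i ∈ s, F i) := fun z => by
  rw [map_sum]; exact Finset.sum_congr rfl fun i _ => h i z

lemma comp_symm_eqOn {f : M → ℂ} {F : smoothAlg B} (hf : Rep e f F) :
    Set.EqOn (f ∘ e.symm) (sext F) B := fun z hz => (hf ⟨z, hz⟩).trans (sext_apply F ⟨z, hz⟩).symm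

lemma del (hB : (B : Set (Fin n → ℂ)) ⊆ e.target) {f : M → ℂ} {F : smoothAlg B} (hf : Rep e f F)
    (k : Fin n) : Rep e (del e k f) (dzDer k F) := fun z => by
  rw [del_apply_symm k f (hB z.2), dz_congr B.isOpen hf.comp_symm_eqOn k z.2]
  conv_rhs => rw [← smk_sext F, dzDer_smk]
  rfl

lemma delBar (hB : (B : Set (Fin n → ℂ)) ⊆ e.target) {f : M → ℂ} {F : smoothAlg B}
    (hf : Rep e f F) (k : Fin n) : Rep e (delBar e k f) (dzbDer k F) := fun z => by
  rw [delBar_apply_symm k f (hB z.2), dzb_congr B.isOpen hf.comp_symm_eqOn k z.2]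
  conv_rhs => rw [← smk_sext F, dzbDer_smk]
  rfl

lemma eval {f : M → ℂ} {F : smoothAlg B} (hf : Rep e f F) {x : M} (hx : x ∈ e.source)
    (hxB : e x ∈ B) : f x = evalAt ⟨e x, hxB⟩ F := by
  rw [← hf ⟨e x, hxB⟩, e.left_inv hx]

end Rep

/-- The open subset of the manifold with coordinates in `B`. -/
def chartSet (e : OpenPartialHomeomorph M (Fin n → ℂ)) (B : Opens (Fin n → ℂ)) : Set M :=
  e.source ∩ e ⁻¹' B

lemma isOpen_chartSet : IsOpen (chartSet e B) := e.isOpen_inter_preimage B.isOpen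

lemma chartSet_subset : chartSet e B ⊆ e.source := Set.inter_subset_left

lemma symm_mem_chartSet (hB : (B : Set (Fin n → ℂ)) ⊆ e.target) (z : B) :
    e.symm z ∈ chartSet e B := by
  refine ⟨e.map_target (hB z.2), ?_⟩
  rw [Set.mem_preimage, e.right_inv (hB z.2)]; exact z.2

lemma image_chartSet (hB : (B : Set (Fin n → ℂ)) ⊆ e.target) :
    e '' chartSet e B = B := by
  ext z; constructor
  · rintro ⟨x, hx, rfl⟩; exact hx.2
  · exact fun hz => ⟨e.symm z, symm_mem_chartSet hB ⟨z, hz⟩, e.right_inv (hB hz)⟩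

lemma Rep.eq_of_eqOn (hB : (B : Set (Fin n → ℂ)) ⊆ e.target) {f f' : M → ℂ} {F F' : smoothAlg B}
    (h : Rep e f F) (h' : Rep e f' F') (hff' : Set.EqOn f f' (chartSet e B)) : F = F' :=
  smoothAlg_ext fun z => by rw [← h, ← h', hff' (symm_mem_chartSet hB z)]

lemma Rep.eqOn {f f' : M → ℂ} {F : smoothAlg B}
    (h : Rep e f F) (h' : Rep e f' F) : Set.EqOn f f' (chartSet e B) := fun x hx => by
  rw [h.eval hx.1 hx.2, h'.eval hx.1 hx.2]

/-- The function on the manifold with a given coordinate expression. -/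
def ofAlg (e : OpenPartialHomeomorph M (Fin n → ℂ)) (F : smoothAlg B) : M → ℂ := sext F ∘ e

lemma rep_ofAlg (hB : (B : Set (Fin n → ℂ)) ⊆ e.target) (F : smoothAlg B) :
    Rep e (ofAlg e F) F := fun z => by
  rw [ofAlg, Function.comp, e.right_inv (hB z.2), sext_apply]; rfl

variable [ChartedSpace (Fin n → ℂ) M]

lemma exists_rep (hB : (B : Set (Fin n → ℂ)) ⊆ e.target) (he : IsHolChart e) {f : M → ℂ}
    (hf : SmoothOn n f (chartSet e B)) : ∃ F : smoothAlg B, Rep e f F := by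
  rw [smoothOn_iff he chartSet_subset, image_chartSet hB] at hf
  exact ⟨smk _ hf, fun z => rfl⟩

lemma Rep.smoothOn (hB : (B : Set (Fin n → ℂ)) ⊆ e.target) (he : IsHolChart e) {f : M → ℂ}
    {F : smoothAlg B} (hf : Rep e f F) : SmoothOn n f (chartSet e B) := by
  rw [smoothOn_iff he chartSet_subset, image_chartSet hB]
  exact (contDiffOn_sext F).congr hf.comp_symm_eqOn

end Represents

section Geometry

variable {n : ℕ} {M : Type*} [TopologicalSpace M] [ChartedSpace (Fin n → ℂ) M]
  {e : OpenPartialHomeomorph M (Fin n → ℂ)} {B : Opens (Fin n → ℂ)} (Ω : PseudoKahlerForm n M)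

/-- `K` is the coordinate expression over `B` of the Kähler geometry of `Ω`. -/
structure IsModel (e : OpenPartialHomeomorph M (Fin n → ℂ))
    (K : KahlerAlgebra (Fin n) (smoothAlg B)) : Prop where
  D : K.D = dzDer
  Db : K.Db = dzbDer
  subset : (B : Set (Fin n → ℂ)) ⊆ e.target
  g : ∀ k l, Rep e (Ω.g e k l) (K.g k l)
  gi : ∀ l k, Rep e (Ω.gInv e l k) (K.gi l k)

lemma exists_model (he : IsHolChart e) {Φ : M → ℝ} (hΦ : Ω.IsPotential e Φ)
    (hB : (B : Set (Fin n → ℂ)) ⊆ e.target) : ∃ K : KahlerAlgebra (Fin n) (smoothAlg B),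
    IsModel Ω e K ∧ Rep e (fun x => (Φ x : ℂ)) K.pot := by
  obtain ⟨P, hP⟩ := exists_rep hB he (hΦ.1.mono chartSet_subset)
  have hg : ∀ k l, Rep e (Ω.g e k l) (dzDer k (dzbDer l P)) := fun k l z => by
    rw [← (hP.delBar hB l).del hB k z]
    exact hΦ.2 _ (symm_mem_chartSet hB z).1 k l
  have hdet : ∀ z : B, (Matrix.of fun a b => Ω.g e a b (e.symm z)).det ≠ 0 := fun z =>
    det_g_ne_zero Ω he (symm_mem_chartSet hB z).1
  have hgi : ∀ l k, ContDiffOn ℝ ∞ (fun z => Ω.gInv e l k (e.symm z)) B := fun l k =>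
    contDiffOn_matrix_inv (A := fun z => Matrix.of fun a b => Ω.g e a b (e.symm z))
      (fun a b => (contDiffOn_sext _).congr (hg a b).comp_symm_eqOn) (fun z hz => hdet ⟨z, hz⟩) l k
  have hgr : ∀ l k, Rep e (Ω.gInv e l k) (smk _ (hgi l k)) := fun l k z => rfl
  refine ⟨⟨dzDer, dzbDer, P, fun l k => smk _ (hgi l k), dzDer_comm, dzbDer_comm, dzDer_dzbDer,
    fun k p => ?_, fun l q => ?_⟩, ⟨rfl, rfl, hB, hg, hgr⟩, hP⟩
  · refine smoothAlg_ext fun z => ?_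
    have := congrFun (congrFun (Matrix.mul_nonsing_inv _ (isUnit_iff_ne_zero.mpr (hdet z))) k) p
    rw [Matrix.mul_apply, Matrix.one_apply] at this
    simp only [map_sum, map_mul, ← hg k _ z]
    rw [apply_ite (evalAt z), map_one, map_zero]
    exact this
  · refine smoothAlg_ext fun z => ?_
    have := congrFun (congrFun (Matrix.nonsing_inv_mul _ (isUnit_iff_ne_zero.mpr (hdet z))) l) q
    rw [Matrix.mul_apply, Matrix.one_apply] at this
    simp only [map_sum, map_mul, ← hg _ q z]
    rw [apply_ite (evalAt z), map_one, map_zero]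
    exact this

namespace IsModel

variable {Ω} {K : KahlerAlgebra (Fin n) (smoothAlg B)} (hK : IsModel Ω e K)
include hK

lemma del {f : M → ℂ} {F : smoothAlg B} (hf : Rep e f F) (k : Fin n) :
    Rep e (del e k f) (K.D k F) := hK.D ▸ hf.del hK.subset k

lemma delBar {f : M → ℂ} {F : smoothAlg B} (hf : Rep e f F) (k : Fin n) :
    Rep e (delBar e k f) (K.Db k F) := hK.Db ▸ hf.delBar hK.subset k

lemma christoffel (k p s : Fin n) : Rep e (Ω.christoffel e k p s) (K.chr k p s) :=
  Rep.sum _ fun t => (hK.del (hK.g p t) k).mul (hK.gi t s)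

lemma christoffelBar (l q t : Fin n) : Rep e (Ω.christoffelBar e l q t) (K.chrb l q t) :=
  Rep.sum _ fun s => (hK.gi t s).mul (hK.delBar (hK.g s q) l)

lemma curvatureUp (l k q p : Fin n) : Rep e (Ω.curvatureUp e l k q p) (K.curvUp l k q p) :=
  Rep.sum _ fun a => Rep.sum _ fun b => ((hK.gi l a).mul (hK.gi b k)).mul
    (Rep.sum _ fun m => (hK.gi q m).mul (hK.delBar (hK.christoffel a m p) b).neg)

variable {f : M → ℂ} {F : smoothAlg B} (hf : Rep e f F)
include hf

lemma cov2 (k p : Fin n) : Rep e (Ω.cov2 e f k p) (K.cov2 F k p) :=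
  (hK.del (hK.del hf k) p).sub (Rep.sum _ fun m => (hK.christoffel p k m).mul (hK.del hf m))

lemma covBar2 (l q : Fin n) : Rep e (Ω.covBar2 e f l q) (K.covb2 F l q) :=
  (hK.delBar (hK.delBar hf l) q).sub
    (Rep.sum _ fun m => (hK.christoffelBar q l m).mul (hK.delBar hf m))

lemma cov3 (k p s : Fin n) : Rep e (Ω.cov3 e f k p s) (K.cov3 F k p s) :=
  ((hK.del (hK.cov2 hf k p) s).sub
    (Rep.sum _ fun m => (hK.christoffel s k m).mul (hK.cov2 hf m p))).sub
    (Rep.sum _ fun m => (hK.christoffel s p m).mul (hK.cov2 hf k m))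

lemma covBar3 (l q t : Fin n) : Rep e (Ω.covBar3 e f l q t) (K.covb3 F l q t) :=
  ((hK.delBar (hK.covBar2 hf l q) t).sub
    (Rep.sum _ fun m => (hK.christoffelBar t l m).mul (hK.covBar2 hf m q))).sub
    (Rep.sum _ fun m => (hK.christoffelBar t q m).mul (hK.covBar2 hf l m))

end IsModel

end Geometry

end KahlerStar

end

/-! ### The star-product in coordinates -/

noncomputable section

namespace KahlerStar

open TopologicalSpace (Opens)

section StarModel

variable {n : ℕ} {M : Type*} [TopologicalSpace M]
  {e : OpenPartialHomeomorph M (Fin n → ℂ)} {B : Opens (Fin n → ℂ)}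

lemma Rep.finsetSum {ι : Type*} (s : Finset ι) {f : ι → M → ℂ} {F : ι → smoothAlg B}
    (h : ∀ i, Rep e (f i) (F i)) : Rep e (∑ i ∈ s, f i) (∑ i ∈ s, F i) := fun z => by
  rw [Finset.sum_apply]; exact Rep.sum s h z

/-- Coordinate expressions of the coefficients of a formal series. -/
def RepSeries (e : OpenPartialHomeomorph M (Fin n → ℂ)) (P : PowerSeries (M → ℂ))
    (F : ℕ → smoothAlg B) : Prop := ∀ r, Rep e (PowerSeries.coeff r P) (F r)

lemma RepSeries.C {f : M → ℂ} {F : smoothAlg B} (hf : Rep e f F) :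
    RepSeries e (PowerSeries.C f) fun r => if r = 0 then F else 0 := fun r => by
  by_cases hr : r = 0
  · simpa [PowerSeries.coeff_C, hr] using hf
  · simpa [PowerSeries.coeff_C, hr] using Rep.zero

lemma RepSeries.eq_of_seriesEqOn (hB : (B : Set (Fin n → ℂ)) ⊆ e.target)
    {P Q : PowerSeries (M → ℂ)} {F G : ℕ → smoothAlg B} (hP : RepSeries e P F)
    (hQ : RepSeries e Q G) (h : SeriesEqOn P Q (chartSet e B)) (r : ℕ) : F r = G r :=
  (hP r).eq_of_eqOn hB (hQ r) (h r)

/-- `c` is the coordinate expression over `B` of the bidifferential operators `C`. -/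
def RepOperators (e : OpenPartialHomeomorph M (Fin n → ℂ))
    (C : ℕ → (M → ℂ) → (M → ℂ) → (M → ℂ)) (c : ℕ → smoothAlg B → smoothAlg B → smoothAlg B) :
    Prop :=
  ∀ r f h F H, Rep e f F → Rep e h H → Rep e (C r f h) (c r F H)

variable {C : ℕ → (M → ℂ) → (M → ℂ) → (M → ℂ)}

lemma RepOperators.star {c : ℕ → smoothAlg B → smoothAlg B → smoothAlg B}
    (hc : RepOperators e C c) {P Q : PowerSeries (M → ℂ)} {F G : ℕ → smoothAlg B} (hP : RepSeries e P F)
    (hQ : RepSeries e Q G) : RepSeries e (star C P Q) fun N =>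
      ∑ a ∈ Finset.HasAntidiagonal.antidiagonal N,
        ∑ b ∈ Finset.HasAntidiagonal.antidiagonal a.2, c a.1 (F b.1) (G b.2) := fun N => by
  rw [KahlerStar.star, PowerSeries.coeff_mk]
  exact Rep.finsetSum _ fun a => Rep.finsetSum _ fun b => hc _ _ _ _ _ (hP _) (hQ _)

variable [ChartedSpace (Fin n → ℂ) M]

lemma RepSeries.smoothSeriesOn (hB : (B : Set (Fin n → ℂ)) ⊆ e.target) (he : IsHolChart e)
    {P : PowerSeries (M → ℂ)} {F : ℕ → smoothAlg B} (hP : RepSeries e P F) :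
    SmoothSeriesOn n P (chartSet e B) := fun r => (hP r).smoothOn hB he

/-- The operators are evaluated on extensions by zero; by locality any other extension gives the
same values over B. -/
lemma exists_repOperators (hB : (B : Set (Fin n → ℂ)) ⊆ e.target) (he : IsHolChart e)
    (hC : ∀ r, IsBidifferential (n := n) (C r)) :
    ∃ c : ℕ → smoothAlg B → smoothAlg B → smoothAlg B, RepOperators e C c := by
  have hs : ∀ F : smoothAlg B, SmoothOn n (ofAlg e F) (chartSet e B) := fun F =>
    (rep_ofAlg hB F).smoothOn hB he
  choose c hc using fun r F H => exists_rep hB he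
    ((hC r).smoothOn he isOpen_chartSet chartSet_subset (hs F) (hs H))
  refine ⟨c, fun r f h F H hf hh z => ?_⟩
  rw [← hc r F H z]
  exact (hC r).congr he isOpen_chartSet chartSet_subset (hf.smoothOn hB he) (hh.smoothOn hB he)
    (hf.eqOn (rep_ofAlg hB F)) (hh.eqOn (rep_ofAlg hB H)) (symm_mem_chartSet hB z)

namespace RepOperators

variable {c : ℕ → smoothAlg B → smoothAlg B → smoothAlg B} (hc : RepOperators e C c)
  (hB : (B : Set (Fin n → ℂ)) ⊆ e.target) (he : IsHolChart e)
include hc hB he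

lemma add_left (hC : ∀ r, IsBidifferential (n := n) (C r)) (r : ℕ) (F F' H : smoothAlg B) :
    c r (F + F') H = c r F H + c r F' H := by
  have hF := rep_ofAlg hB F
  have hF' := rep_ofAlg hB F'
  have hH := rep_ofAlg hB H
  exact (hc r _ _ _ _ (hF.add hF') hH).eq_of_eqOn hB
    ((hc r _ _ _ _ hF hH).add (hc r _ _ _ _ hF' hH))
    ((hC r).add_left he isOpen_chartSet chartSet_subset (hF.smoothOn hB he) (hF'.smoothOn hB he)
      (hH.smoothOn hB he))

lemma add_right (hC : ∀ r, IsBidifferential (n := n) (C r)) (r : ℕ) (F H H' : smoothAlg B) :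
    c r F (H + H') = c r F H + c r F H' := by
  have hF := rep_ofAlg hB F
  have hH := rep_ofAlg hB H
  have hH' := rep_ofAlg hB H'
  exact (hc r _ _ _ _ hF (hH.add hH')).eq_of_eqOn hB
    ((hc r _ _ _ _ hF hH).add (hc r _ _ _ _ hF hH'))
    ((hC r).add_right he isOpen_chartSet chartSet_subset (hF.smoothOn hB he) (hH.smoothOn hB he)
      (hH'.smoothOn hB he))

lemma zero_left (hC : ∀ r, IsBidifferential (n := n) (C r)) (r : ℕ) (H : smoothAlg B) :
    c r 0 H = 0 := by simpa using hc.add_left hB he hC r 0 0 H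

lemma zero_right (hC : ∀ r, IsBidifferential (n := n) (C r)) (r : ℕ) (F : smoothAlg B) :
    c r F 0 = 0 := by simpa using hc.add_right hB he hC r F 0 0

lemma star_C_left (hC : ∀ r, IsBidifferential (n := n) (C r)) {f : M → ℂ} {F : smoothAlg B}
    (hf : Rep e f F) {Q : PowerSeries (M → ℂ)} {G : ℕ → smoothAlg B} (hQ : RepSeries e Q G) :
    RepSeries e (KahlerStar.star C (PowerSeries.C f) Q) fun N =>
      ∑ a ∈ Finset.HasAntidiagonal.antidiagonal N, c a.1 F (G a.2) := by
  convert hc.star (RepSeries.C hf) hQ using 2 with N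
  refine Finset.sum_congr rfl fun a _ => ?_
  rw [Finset.sum_eq_single (0, a.2)]
  · simp
  · rintro ⟨i, j⟩ hb hne
    rw [Finset.HasAntidiagonal.mem_antidiagonal] at hb
    have : i ≠ 0 := by rintro rfl; exact hne (by simpa using hb)
    simp [this, hc.zero_left hB he hC]
  · simp

lemma star_C_right (hC : ∀ r, IsBidifferential (n := n) (C r)) {h : M → ℂ} {H : smoothAlg B}
    (hh : Rep e h H) {P : PowerSeries (M → ℂ)} {F : ℕ → smoothAlg B} (hP : RepSeries e P F) :
    RepSeries e (KahlerStar.star C P (PowerSeries.C h)) fun N =>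
      ∑ a ∈ Finset.HasAntidiagonal.antidiagonal N, c a.1 (F a.2) H := by
  convert hc.star hP (RepSeries.C hh) using 2 with N
  refine Finset.sum_congr rfl fun a _ => ?_
  rw [Finset.sum_eq_single (a.2, 0)]
  · simp
  · rintro ⟨i, j⟩ hb hne
    rw [Finset.HasAntidiagonal.mem_antidiagonal] at hb
    have : j ≠ 0 := by rintro rfl; exact hne (by simpa using hb)
    simp [this, hc.zero_right hB he hC]
  · simp

lemma star_C_C (hC : ∀ r, IsBidifferential (n := n) (C r)) {f h : M → ℂ} {F H : smoothAlg B}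
    (hf : Rep e f F) (hh : Rep e h H) :
    RepSeries e (KahlerStar.star C (PowerSeries.C f) (PowerSeries.C h)) fun N => c N F H := by
  convert hc.star_C_left hB he hC hf (RepSeries.C hh) using 2 with N
  rw [Finset.sum_eq_single (N, 0)]
  · simp
  · rintro ⟨i, j⟩ hb hne
    rw [Finset.HasAntidiagonal.mem_antidiagonal] at hb
    have : j ≠ 0 := by rintro rfl; exact hne (by simpa using hb)
    simp [this, hc.zero_right hB he hC]
  · simp

lemma eq_zero_of_holomorphic {Ω : PseudoKahlerForm n M} (hC : IsStandard Ω C) {a : M → ℂ}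
    {A : smoothAlg B} (ha : Rep e a A) (hol : HolomorphicOn n a (chartSet e B)) (r : ℕ)
    (H : smoothAlg B) : c (r + 1) A H = 0 := by
  have hH := rep_ofAlg hB H
  have := (hc.star_C_C hB he hC.bidifferential ha hH).eq_of_seriesEqOn hB
    (RepSeries.C (ha.mul hH))
    (hC.left_holomorphic _ _ _ isOpen_chartSet hol (hH.smoothOn hB he)) (r + 1)
  simpa using this

lemma star_potential {Ω : PseudoKahlerForm n M} (hC : IsStandard Ω C) {Φ : M → ℝ}
    (hΦ : Ω.IsPotential e Φ) (hconv : Convex ℝ (B : Set (Fin n → ℂ)))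
    (hne : (B : Set (Fin n → ℂ)).Nonempty) {K : KahlerAlgebra (Fin n) (smoothAlg B)}
    (hK : IsModel Ω e K) (hpot : Rep e (fun x => (Φ x : ℂ)) K.pot) (k : Fin n) (r : ℕ)
    (H : smoothAlg B) :
    c (r + 1) (K.D k K.pot) H = if r = 0 then K.D k H else 0 := by
  have hH := rep_ofAlg hB H
  have hU := hK.del hpot k
  -- The formula for left multiplication by ∂_kΦ is available on contractible charts only.
  -- Restricting e to the preimage of the convex set B gives such a chart without changing
  -- coordinates, metric or derivatives.
  have hsource : (e.restr (chartSet e B)).source = chartSet e B := by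
    rw [e.restr_source, isOpen_chartSet.interior_eq]
    exact Set.inter_eq_right.mpr chartSet_subset
  have htarget : (e.restr (chartSet e B)).target = B := by
    rw [← (e.restr (chartSet e B)).image_source_eq_target, hsource]
    exact image_chartSet hB
  have hcontr : ContractibleSpace (e.restr (chartSet e B)).source := by
    have : ContractibleSpace (B : Set (Fin n → ℂ)) := hconv.contractibleSpace hne
    exact ((e.restr (chartSet e B)).toHomeomorphSourceTarget.trans
      (Homeomorph.setCongr htarget)).contractibleSpace
  have hpot' : Ω.IsPotential (e.restr (chartSet e B)) Φ := by
    have hsub : (e.restr (chartSet e B)).source ⊆ e.source := by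
      rw [hsource]; exact chartSet_subset
    exact ⟨hΦ.1.mono hsub, fun x hx => hΦ.2 x (hsub hx)⟩
  have hstar := hC.left_potential (e.restr (chartSet e B))
    (restr_mem_maximalAtlas _ he isOpen_chartSet) hcontr Φ hpot' k (ofAlg e H)
    (by rw [hsource]; exact hH.smoothOn hB he)
  rw [hsource] at hstar
  have hleft := hc.star_C_C hB he hC.bidifferential hU hH (r + 1)
  have hright : Rep e (PowerSeries.coeff (r + 1) (PowerSeries.C ((del e k fun x => (Φ x : ℂ))
      * ofAlg e H) + PowerSeries.X * PowerSeries.C (del e k (ofAlg e H))))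
      (if r = 0 then K.D k H else 0) := by
    rw [map_add, PowerSeries.coeff_succ_X_mul, PowerSeries.coeff_C, if_neg (Nat.succ_ne_zero r),
      zero_add]
    exact RepSeries.C (hK.del hH k) r
  exact hleft.eq_of_eqOn hB hright (hstar (r + 1))

lemma isStdStar {Ω : PseudoKahlerForm n M} (hC : IsStandard Ω C) {Φ : M → ℝ}
    (hΦ : Ω.IsPotential e Φ) (hconv : Convex ℝ (B : Set (Fin n → ℂ)))
    (hne : (B : Set (Fin n → ℂ)).Nonempty) {K : KahlerAlgebra (Fin n) (smoothAlg B)}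
    (hK : IsModel Ω e K) (hpot : Rep e (fun x => (Φ x : ℂ)) K.pot) :
    K.IsStdStar (coord B) c where
  add_left := hc.add_left hB he hC.bidifferential
  zeroth F H := by
    have hF := rep_ofAlg hB F
    have hH := rep_ofAlg hB H
    exact (hc 0 _ _ _ _ hF hH).eq_of_eqOn hB (hF.mul hH)
      (hC.zeroth _ _ _ isOpen_chartSet (hF.smoothOn hB he) (hH.smoothOn hB he))
  one_left r H := by
    have hH := RepSeries.C (rep_ofAlg hB H)
    have hone := hC.one_left _ _ isOpen_chartSet (hH.smoothSeriesOn hB he)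
    rw [← map_one (PowerSeries.C (R := M → ℂ))] at hone
    have := (hc.star_C_C hB he hC.bidifferential Rep.one (rep_ofAlg hB H)).eq_of_seriesEqOn hB hH
      hone (r + 1)
    simpa using this
  assoc r F F' H := by
    have hF := rep_ofAlg hB F
    have hF' := rep_ofAlg hB F'
    have hH := rep_ofAlg hB H
    have hs := hC.bidifferential
    exact (hc.star_C_right hB he hs hH (hc.star_C_C hB he hs hF hF')).eq_of_seriesEqOn hB
      (hc.star_C_left hB he hs hF (hc.star_C_C hB he hs hF' hH))
      (hC.assoc _ _ _ _ isOpen_chartSet ((RepSeries.C hF).smoothSeriesOn hB he)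
        ((RepSeries.C hF').smoothSeriesOn hB he) ((RepSeries.C hH).smoothSeriesOn hB he)) r
  const r a H := hc.eq_zero_of_holomorphic hB he hC (Rep.const a) mdifferentiableOn_const r H
  coord r k H := by
    have hrep : Rep e (fun x => e x k) (coord B k) := fun z => by
      exact congrFun (e.right_inv (hB z.2)) k
    refine hc.eq_zero_of_holomorphic hB he hC hrep (fun x hx => ?_) r H
    have he1 : e ∈ IsManifold.maximalAtlas 𝓘(ℂ, Fin n → ℂ) 1 M :=
      IsManifold.maximalAtlas_subset_of_le le_top he
    have h1 := mdifferentiableAt_of_mem_maximalAtlas he1 hx.1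
    have h2 : MDifferentiableAt 𝓘(ℂ, Fin n → ℂ) 𝓘(ℂ, ℂ) (fun z : Fin n → ℂ => z k) (e x) :=
      (ContinuousLinearMap.proj (R := ℂ) (φ := fun _ : Fin n => ℂ)
        k).differentiableAt.mdifferentiableAt
    exact (h2.comp x h1).mdifferentiableWithinAt
  pot_one k H := by simpa using hc.star_potential hB he hC hΦ hconv hne hK hpot k 0 H
  pot r k H := by simpa using hc.star_potential hB he hC hΦ hconv hne hK hpot k (r + 1) H

end RepOperators

end StarModel

end KahlerStar

end

/-! ### Localization to a ball and conclusion -/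

open KahlerStar in
theorem mainTheorem1 {n : ℕ} {M : Type*} [TopologicalSpace M] [ChartedSpace (Fin n → ℂ) M]
    [IsManifold 𝓘(ℂ, Fin n → ℂ) ω M] (Ω : PseudoKahlerForm n M)
    (C : ℕ → (M → ℂ) → (M → ℂ) → (M → ℂ)) (hC : IsStandard Ω C)
    (e : OpenPartialHomeomorph M (Fin n → ℂ)) (he : IsHolChart e)
    (Φ : M → ℝ) (hΦ : Ω.IsPotential e Φ)
    (U : Set M) (hU : IsOpen U) (hUe : U ⊆ e.source)
    (φ ψ : M → ℂ) (hφ : SmoothOn n φ U) (hψ : SmoothOn n ψ U) (x : M) (hx : x ∈ U) :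
    C 1 φ ψ x = ∑ l, ∑ k, Ω.gInv e l k x * delBar e l φ x * del e k ψ x ∧
    C 2 φ ψ x = 1 / 2 * ∑ l, ∑ k, ∑ q, ∑ p,
      (Ω.gInv e q p x * Ω.gInv e l k x *
          delBar e l (delBar e q φ) x * del e k (del e p ψ) x
        + Ω.gInv e q p x * del e p (Ω.gInv e l k) x *
          delBar e l (delBar e q φ) x * del e k ψ x
        + delBar e l (Ω.gInv e q p) x * Ω.gInv e l k x *
          delBar e q φ x * del e k (del e p ψ) x
        + delBar e l (Ω.gInv e q p) x * del e p (Ω.gInv e l k) x *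
          delBar e q φ x * del e k ψ x) ∧
    C 2 φ ψ x = 1 / 2 * ∑ l, ∑ k, ∑ q, ∑ p,
      Ω.gInv e l k x * Ω.gInv e q p x * Ω.covBar2 e φ l q x * Ω.cov2 e ψ k p x ∧
    C 3 φ ψ x =
      1 / 6 * ∑ l, ∑ k, ∑ q, ∑ p, ∑ t, ∑ s,
        Ω.gInv e l k x * Ω.gInv e q p x * Ω.gInv e t s x *
          Ω.covBar3 e φ l q t x * Ω.cov3 e ψ k p s x
      + 1 / 4 * ∑ l, ∑ k, ∑ q, ∑ p,
        Ω.curvatureUp e l k q p x * Ω.covBar2 e φ l q x * Ω.cov2 e ψ k p x := by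
  have hxe : x ∈ e.source := hUe hx
  have hOe : e '' U ⊆ e.target := image_subset_target hUe
  -- The ball lies in the image of U, and the averages of g over all segments within it are
  -- invertible, as the expansion at each of its points requires.
  obtain ⟨ρ, hρ, hρU, hdet⟩ := exists_ball_det_average_ne_zero
    (G := fun k l z => Ω.g e k l (e.symm z)) (e.isOpen_image_of_subset_source hU hUe)
    (Set.mem_image_of_mem e hx)
    (fun k l => ((smoothOn_iff he hUe).mp ((Ω.smooth e he k l).mono hUe)).continuousOn)
    (by simpa only [e.left_inv hxe] using det_g_ne_zero Ω he hxe)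
  let B : TopologicalSpace.Opens (Fin n → ℂ) := ⟨Metric.ball (e x) ρ, Metric.isOpen_ball⟩
  have hBc : Convex ℝ (B : Set (Fin n → ℂ)) := convex_ball _ _
  have hB : (B : Set (Fin n → ℂ)) ⊆ e.target := hρU.trans hOe
  have hxB : e x ∈ B := Metric.mem_ball_self hρ
  have hsub : chartSet e B ⊆ U := fun y hy => by
    obtain ⟨u, hu, huy⟩ := hρU hy.2
    rwa [← e.injOn (hUe hu) hy.1 huy]
  obtain ⟨K, hK, hpot⟩ := exists_model Ω he hΦ hB
  obtain ⟨c, hc⟩ := exists_repOperators hB he hC.bidifferential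
  have hstd := hc.isStdStar hB he hC hΦ hBc ⟨e x, hxB⟩ hK hpot
  have hexp : ∀ y : B, K.HasExpansion (coord B) (evalAt y) := fun y =>
    hasExpansion K hK.Db hBc y fun z => by
      have hInt : ∀ k l, ∫ t in (0 : ℝ)..1, sext (K.g k l) (y + t • ((z : Fin n → ℂ) - y))
          = ∫ t in (0 : ℝ)..1, Ω.g e k l (e.symm (y + t • ((z : Fin n → ℂ) - y))) := fun k l =>
        intervalIntegral.integral_congr fun t ht => by
          rw [Set.uIcc_of_le zero_le_one] at ht
          exact ((hK.g k l).comp_symm_eqOn (segment_point_mem hBc y.2 z.2 ht)).symm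
      simp only [hInt]
      exact hdet y y.2 z z.2
  have hinj : ∀ F : smoothAlg B, (∀ y, evalAt y F = 0) → F = 0 := fun F hF =>
    smoothAlg_ext fun z => by rw [hF, map_zero]
  have hz : ∀ k l, K.Db l (coord B k) = 0 := fun k l => by rw [hK.Db, dzbDer_coord]
  obtain ⟨F, hF⟩ := exists_rep hB he (hφ.mono hsub)
  obtain ⟨H, hH⟩ := exists_rep hB he (hψ.mono hsub)
  have ev : ∀ {f : M → ℂ} {G : smoothAlg B}, Rep e f G → f x = evalAt ⟨e x, hxB⟩ G :=
    fun h => h.eval hxe hxB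
  refine ⟨?_, ?_, ?_, ?_⟩
  · rw [ev (hc 1 _ _ _ _ hF hH), hstd.first_eq hexp hinj hz]
    exact (ev (Rep.sum _ fun l => Rep.sum _ fun k =>
      ((hK.gi l k).mul (hK.delBar hF l)).mul (hK.del hH k))).symm
  · rw [ev (hc 2 _ _ _ _ hF hH), hstd.second_eq hexp hinj hz, K.B2_eq_coordinates]
    exact (ev (Rep.const_mul (1 / 2) (Rep.sum _ fun l => Rep.sum _ fun k => Rep.sum _ fun q =>
      Rep.sum _ fun p =>
        ((((((hK.gi q p).mul (hK.gi l k)).mul (hK.delBar (hK.delBar hF q) l)).mul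
          (hK.del (hK.del hH p) k)).add
        ((((hK.gi q p).mul (hK.del (hK.gi l k) p)).mul (hK.delBar (hK.delBar hF q) l)).mul
          (hK.del hH k))).add
        ((((hK.delBar (hK.gi q p) l).mul (hK.gi l k)).mul (hK.delBar hF q)).mul
          (hK.del (hK.del hH p) k))).add
        ((((hK.delBar (hK.gi q p) l).mul (hK.del (hK.gi l k) p)).mul (hK.delBar hF q)).mul
          (hK.del hH k))))).symm
  · rw [ev (hc 2 _ _ _ _ hF hH), hstd.second_eq hexp hinj hz]
    exact (ev (Rep.const_mul (1 / 2) (Rep.sum _ fun l => Rep.sum _ fun k => Rep.sum _ fun q =>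
      Rep.sum _ fun p => (((hK.gi l k).mul (hK.gi q p)).mul (hK.covBar2 hF l q)).mul
        (hK.cov2 hH k p)))).symm
  · rw [ev (hc 3 _ _ _ _ hF hH), hstd.third_eq hexp hinj hz]
    exact (ev ((Rep.const_mul (1 / 6) (Rep.sum _ fun l => Rep.sum _ fun k => Rep.sum _ fun q =>
      Rep.sum _ fun p => Rep.sum _ fun t => Rep.sum _ fun s =>
        ((((hK.gi l k).mul (hK.gi q p)).mul (hK.gi t s)).mul (hK.covBar3 hF l q t)).mul
          (hK.cov3 hH k p s))).add
      (Rep.const_mul (1 / 4) (Rep.sum _ fun l => Rep.sum _ fun k => Rep.sum _ fun q =>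
        Rep.sum _ fun p => ((hK.curvatureUp l k q p).mul (hK.covBar2 hF l q)).mul
          (hK.cov2 hH k p))))).symm
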